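/- Let $\mathbf F_q$ be a finite field with $q$ elements, and let $K=\mathbf F_q((x))$ be the field of formal Laurent series with the absolute value normalised by $|x|=q^{-1}$. Let $O=\{z\in K:|z|\le 1\}$, and let $\overline K$ be the completion of an algebraic closure of $K$, with the extended absolute value. Let $X$ be the Banach space over $\overline K$ of all continuous $\mathbf F_q$-linear functions $O\to\overline K$, with the supremum norm. For $i\ge 0$ put $[i]=x^{q^i}-x$, $D_i=[i][i-1]^q\cdots[1]^{q^{i-1}}$, $L_i=[i][i-1]\cdots[1]$, $D_0=L_0=1$. The Carlitz polynomials are $$f_i(t)=D_i^{-1}\prod_{m\in\mathbf F_q[x],\ \deg m<i}(t-m),\qquad i\ge 0,\qquad f_0(t)=t.$$ Put $$e_C(z)=\sum_{j\ge 0}\frac{z^{q^j}}{D_j}\ \ (|z|<q^{-1/(q-1)}),\qquad \rho(\zeta)=\sum_{n\ge 0}(-1)^n\frac{\zeta^{q^n}}{L_n}\ \ (|\zeta|<1).$$ An operator on $X$ is called $\mathbf F_q$-linear if it is additive and commutes with multiplication by elements of $\mathbf F_q$. Let $R_qu=u^q$ and $(\Delta\varphi)(t)=\varphi(xt)-x\varphi(t)$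 for $u,\varphi\in X$. **Theorem.** The operator $R_q$ is injective on $X$ and $\Delta$ maps $X$ into $\{u^q:u\in X\}$, so that $a^+=R_q-I$ and $a^-=\sqrt[q]{\ }\circ\Delta$ (where $\sqrt[q]{\ }$ is the inverse of $R_q$) are well-defined operators on $X$. Moreover, the following statements hold. (i) $a^+$ and $a^-$ are continuous $\mathbf F_q$-linear operators on $X$, and $a^-a^+-a^+a^-=[1]^{1/q}I$. (ii) All $f_i$ belong to $X$, and they form an orthonormal basis of $X$: every $\varphi\in X$ can be written in exactly one way as a uniformly convergent series $\varphi=\sum_{i\ge 0}c_if_i$ with $c_i\in\overline K$, $c_i\to 0$, and $\|\varphi\|=\sup_i|c_i|$. For all $i\ge 0$ one has $a^+a^-f_i=[i]f_i$. For all $i\ge 1$ one has $a^+f_{i-1}=[i]f_i$ and $a^-f_i=f_{i-1}$; also, $a^-f_0=0$. (iii) For every $\lambda\in\overline K$ the equation $a^-u=\lambda u$ has a nonzero solution $u\in X$. Let $\lambda\ne 0$. Then $\lambda$ has a $(q-1)$-th root in $\overline K$; let $\lambda^{1/(q-1)}$ be any value of it, and put $\lambda^{-q/(q-1)}=(\lambda^{1/(q-1)})^{-q}$.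 The solutions $u\in X$ of $a^-u=\lambda u$ are exactly the functions $$u(t)=\lambda^{-q/(q-1)}\sum_{n=0}^\infty c^{q^n}f_n(t),\qquad c\in\overline K,\ |c|<1, \tag{1}$$ where the series converges in $X$. If in (1) $|c|<q^{-1/(q-1)}$, then $$u(t)=\lambda^{-q/(q-1)}e_C(tz)\quad (t\in O),\qquad z=\rho(c), \tag{2}$$ where $|z|<q^{-1/(q-1)}$ and the series for $\rho(c)$ and $e_C(tz)$ converge. In particular, if $q\ne 2$, then every function (1) with $c\in K$, $|c|<1$, has the form (2). -/

import Mathlib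

open Filter Topology
open scoped NNReal WithZero

noncomputable section

namespace CarlitzOscillator

/-! ## The local field `K = F((x))`, its ring of integers and the field `K̄` -/

/-- The number `q` of elements of the finite field `F`. -/
abbrev qq (F : Type*) : ℕ := Nat.card F

/-- The field of formal Laurent series over `F`. -/
abbrev KK (F : Type*) [Field F] : Type _ := LaurentSeries F

section Field

variable (F : Type*) [Field F] [Finite F]

theorem one_lt_qq : 1 < qq F := Finite.one_lt_card

theorem one_lt_qq_nnreal : (1 : ℝ≥0) < (qq F : ℝ≥0) := by
  exact_mod_cast one_lt_qq F

open MonoidWithZeroHom in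
/-- The real-valued absolute value on `K` is normalised so that `|x| = q⁻¹`
(see `norm_eq` and `norm_single` below). -/
instance rankOne : (Valued.v : Valuation (KK F) ℤᵐ⁰).RankOne where
  hom' := (WithZeroMulInt.toNNReal (one_lt_qq_nnreal F).ne_zero).comp ValueGroup₀.embedding
  strictMono' :=
    (WithZeroMulInt.toNNReal_strictMono (one_lt_qq_nnreal F)).comp
      ValueGroup₀.embedding_strictMono
  exists_val_nontrivial := by
    obtain ⟨z, hz⟩ := LaurentSeries.valuation_surjective F (WithZero.exp (-1 : ℤ))
    refine ⟨z, ?_, ?_⟩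
    · rw [hz]; exact WithZero.exp_ne_zero
    · rw [hz]; decide

/-- `K` with its non-Archimedean absolute value. -/
instance normK : NontriviallyNormedField (KK F) := Valued.toNontriviallyNormedField (KK F) ℤᵐ⁰

theorem norm_eq (z : KK F) :
    ‖z‖ = WithZeroMulInt.toNNReal (one_lt_qq_nnreal F).ne_zero (Valued.v z) := by
  rw [← Valuation.embedding_restrict Valued.v z]
  rfl

theorem norm_single (n : ℤ) : ‖(HahnSeries.single n (1 : F) : KK F)‖ = (qq F : ℝ) ^ (-n) := by
  rw [norm_eq, LaurentSeries.valuation_single_zpow,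
    WithZeroMulInt.toNNReal_neg_apply _ WithZero.exp_ne_zero]
  have h : (WithZero.unzero (WithZero.exp_ne_zero (a := -n))) = Multiplicative.ofAdd (-n) := rfl
  rw [h]
  simp

instance : IsUltrametricDist (KK F) :=
  inferInstance

instance : CompleteSpace (KK F) := LaurentSeries.instLaurentSeriesComplete

/-- The algebraic closure of `K`. -/
abbrev Kac : Type _ := AlgebraicClosure (KK F)

/-- The absolute value of `K_ac` is the unique extension of the one of `K`. -/
instance normKac : NormedField (Kac F) := spectralNorm.normedField (KK F) (Kac F)

instance : NormedAlgebra (KK F) (Kac F) := spectralNorm.normedAlgebra (KK F) (Kac F)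

instance : UniformContinuousConstSMul (KK F) (Kac F) :=
  uniformContinuousConstSMul_of_continuousConstSMul (KK F) (Kac F)

/-- The completion `K̄` of the algebraic closure of `K`. -/
abbrev Kbar : Type _ := UniformSpace.Completion (Kac F)

/-- The canonical embedding `K → K̄`. -/
def emb : KK F →+* Kbar F := (algebraMap (Kac F) (Kbar F)).comp (algebraMap (KK F) (Kac F))

theorem norm_emb (z : KK F) : ‖emb F z‖ = ‖z‖ := by
  change ‖((algebraMap (KK F) (Kac F) z : Kac F) : Kbar F)‖ = ‖z‖
  rw [UniformSpace.Completion.norm_coe, norm_algebraMap']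

/-- The ring of integers `O = {z ∈ K : |z| ≤ 1}`. -/
abbrev OO : Type _ := Valued.integer (KK F)

theorem mem_OO (z : KK F) : z ∈ Valued.integer (KK F) ↔ ‖z‖ ≤ 1 :=
  (Valuation.mem_integer_iff _ _).trans Valued.toNormedField.norm_le_one_iff.symm

theorem powerSeries_mem (f : PowerSeries F) :
    (HahnSeries.ofPowerSeries ℤ F f : KK F) ∈ Valued.integer (KK F) :=
  (Valuation.mem_integer_iff _ _).2 ((LaurentSeries.val_le_one_iff_eq_coe F _).2 ⟨f, rfl⟩)

instance : CompactSpace (OO F) := by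
  let _ : TopologicalSpace F := ⊥
  have : DiscreteTopology F := ⟨rfl⟩
  let g : (ℕ → F) → OO F := fun a => ⟨HahnSeries.ofPowerSeries ℤ F (PowerSeries.mk a),
    powerSeries_mem F _⟩
  have hg : Function.Surjective g := by
    rintro ⟨z, hz⟩
    obtain ⟨f, hf⟩ := (LaurentSeries.val_le_one_iff_eq_coe F z).1 hz
    refine ⟨fun n => PowerSeries.coeff n f, Subtype.ext (Eq.trans ?_ hf)⟩
    change HahnSeries.ofPowerSeries ℤ F (PowerSeries.mk _) = _
    congr 1
    ext n
    simp
  have hc : Continuous g := by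
    refine Continuous.subtype_mk (continuous_iff_continuousAt.2 fun a => ?_) _
    refine Metric.tendsto_nhds.2 fun ε hε => ?_
    obtain ⟨n, hn⟩ := exists_pow_lt_of_lt_one hε
      (inv_lt_one_of_one_lt₀ (by exact_mod_cast one_lt_qq F : (1 : ℝ) < qq F))
    have hU : ∀ᶠ b : ℕ → F in 𝓝 a, ∀ i ∈ Finset.range n, b i = a i := by
      rw [Filter.eventually_all_finset]
      intro i _
      exact (continuous_apply i).continuousAt.eventually
        ((isOpen_discrete {a i}).mem_nhds (Set.mem_singleton (a i)))
    filter_upwards [hU] with b hb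
    rw [dist_eq_norm]
    refine lt_of_le_of_lt ?_ hn
    have h1 : ‖(HahnSeries.single (n : ℤ) (1 : F) : KK F)‖ = ((qq F : ℝ)⁻¹) ^ n := by
      rw [norm_single, zpow_neg, zpow_natCast, inv_pow]
    rw [← h1]
    refine Valued.toNormedField.norm_le_iff.2 ?_
    rw [LaurentSeries.valuation_single_zpow, ← map_sub]
    refine (LaurentSeries.intValuation_le_iff_coeff_lt_eq_zero F _).2 fun m hm => ?_
    rw [map_sub, PowerSeries.coeff_mk, PowerSeries.coeff_mk, hb m (Finset.mem_range.2 hm), sub_self]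
  exact hg.compactSpace hc

/-- The constant `β ∈ F` as an element of `O`. -/
def cO (β : F) : OO F := ⟨HahnSeries.ofPowerSeries ℤ F (PowerSeries.C β), powerSeries_mem F _⟩

/-- The indeterminate `x` as an element of `O`. -/
def xO : OO F := ⟨HahnSeries.ofPowerSeries ℤ F PowerSeries.X, powerSeries_mem F _⟩

/-- The constant `β ∈ F` as an element of `K̄`. -/
def cbar : F →+* Kbar F := (emb F).comp HahnSeries.C

theorem emb_cO (β : F) : emb F (cO F β) = cbar F β := by
  simp [cO, cbar]

/-! ## The Banach space `X` -/

/-- The space `X` of all continuous `F`-linear functions `O → K̄`; its norm is the supremum norm,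
inherited from `C(O, K̄)`. -/
def XX : Submodule (Kbar F) C(OO F, Kbar F) where
  carrier := {φ | (∀ s t, φ (s + t) = φ s + φ t) ∧ ∀ (β : F) t, φ (cO F β * t) = cbar F β * φ t}
  add_mem' := by
    rintro φ ψ ⟨h1, h2⟩ ⟨h3, h4⟩
    refine ⟨fun s t => ?_, fun β t => ?_⟩
    · simp only [ContinuousMap.add_apply, h1, h3]; ring
    · simp only [ContinuousMap.add_apply, h2, h4]; ring
  zero_mem' := by simp
  smul_mem' := by
    rintro a φ ⟨h1, h2⟩
    refine ⟨fun s t => ?_, fun β t => ?_⟩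
    · simp only [ContinuousMap.smul_apply, h1, smul_eq_mul]; ring
    · simp only [ContinuousMap.smul_apply, h2, smul_eq_mul]; ring

instance : CompleteSpace (XX F) := by
  have h : IsClosed (XX F : Set C(OO F, Kbar F)) := by
    have e : (XX F : Set C(OO F, Kbar F)) =
        (⋂ s, ⋂ t, {φ | φ (s + t) = φ s + φ t}) ∩
          ⋂ β, ⋂ t, {φ | φ (cO F β * t) = cbar F β * φ t} := by
      ext φ
      simp [XX]
    rw [e]
    refine IsClosed.inter ?_ ?_
    · refine isClosed_iInter fun s => isClosed_iInter fun t => isClosed_eq ?_ ?_ <;> fun_prop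
    · refine isClosed_iInter fun s => isClosed_iInter fun t => isClosed_eq ?_ ?_ <;> fun_prop
  exact h.completeSpace_coe

variable {F}

/-- The value `φ(t)`. -/
def ev (φ : XX F) (t : OO F) : Kbar F := φ.1 t

/-! ## The operators -/

/-- An operator on `X` is `F`-linear if it is additive and commutes with multiplication by the
constants `β ∈ F`. -/
def IsFLinear (A : XX F → XX F) : Prop :=
  (∀ u v, A (u + v) = A u + A v) ∧ ∀ (β : F) u, A (cbar F β • u) = cbar F β • A u

theorem charP_Kbar (p : ℕ) [CharP F p] : CharP (Kbar F) p :=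
  charP_of_injective_ringHom (cbar F).injective p

/-- The operator `R_q u = u^q` on `X`. -/
def Rq (u : XX F) : XX F :=
  ⟨u.1 ^ qq F, by
    let _ := Fintype.ofFinite F
    obtain ⟨p, hp⟩ := CharP.exists F
    obtain ⟨n, hpp, hn⟩ := FiniteField.card F p
    have hq : qq F = p ^ (n : ℕ) := by rw [← hn]; exact Nat.card_eq_fintype_card
    have : Fact p.Prime := ⟨hpp⟩
    have := charP_Kbar (F := F) p
    obtain ⟨u, h1, h2⟩ := u
    refine ⟨fun s t => ?_, fun β t => ?_⟩
    · simp only [ContinuousMap.pow_apply, h1, hq]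
      exact add_pow_char_pow _ _ p n
    · simp only [ContinuousMap.pow_apply, h2, mul_pow]
      rw [← map_pow, hq, ← hn, FiniteField.pow_card]⟩

/-- The difference operator `(Δφ)(t) = φ(xt) - xφ(t)` on `X`. -/
def Delta (u : XX F) : XX F :=
  ⟨u.1.comp ⟨fun t => xO F * t, by fun_prop⟩ - emb F (xO F) • u.1, by
    obtain ⟨u, h1, h2⟩ := u
    refine ⟨fun s t => ?_, fun β t => ?_⟩
    · simp only [ContinuousMap.sub_apply, ContinuousMap.comp_apply, ContinuousMap.coe_mk,
        ContinuousMap.smul_apply, mul_add, h1, smul_eq_mul]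
      ring
    · simp only [ContinuousMap.sub_apply, ContinuousMap.comp_apply, ContinuousMap.coe_mk,
        ContinuousMap.smul_apply, mul_left_comm (xO F), h2, smul_eq_mul]
      ring⟩

/-- The `q`-th root on `X`, the inverse of the (injective) operator `R_q`. It is meaningful only on
the range `{u^q : u ∈ X}` of `R_q`; outside of it, it takes a junk value. -/
def qRoot : XX F → XX F := Function.invFun Rq

/-- The creation operator `a⁺ = R_q - I`. -/
def aPlus (u : XX F) : XX F := Rq u - u

/-- The annihilation operator: the `q`-th root composed with `Δ`. -/
def aMinus (u : XX F) : XX F := qRoot (Delta u)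

variable (F)

/-! ## Carlitz polynomials and the Carlitz exponential -/

/-- `[i] = x^(q^i) - x`. -/
def br (i : ℕ) : KK F := (xO F : KK F) ^ qq F ^ i - xO F

/-- `D_i = [i] [i-1]^q ⋯ [1]^(q^(i-1))`, `D_0 = 1`. -/
def DD (i : ℕ) : KK F := ∏ j ∈ Finset.range i, br F (i - j) ^ qq F ^ j

/-- `L_i = [i] [i-1] ⋯ [1]`, `L_0 = 1`. -/
def LL (i : ℕ) : KK F := ∏ j ∈ Finset.range i, br F (i - j)

/-- A polynomial `m ∈ F[x]` as an element of `K`. -/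
def polyK (m : Polynomial F) : KK F := HahnSeries.ofPowerSeries ℤ F (m : PowerSeries F)

/-- `e_i(t) = ∏ (t - m)`, the product over all `m ∈ F[x]` with `deg m < i`; `e_0(t) = t`. -/
def ee (i : ℕ) (t : KK F) : KK F :=
  ∏ᶠ m ∈ {m : Polynomial F | m.degree < (i : WithBot ℕ)}, (t - polyK F m)

/-- The Carlitz polynomial `f_i(t) = e_i(t) / D_i`. -/
def ff (i : ℕ) (t : KK F) : KK F := (DD F i)⁻¹ * ee F i t

variable {F}

/-- The terms of the Carlitz exponential `e_C(z) = ∑ z^(q^j) / D_j`. -/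
def eCTerm (z : Kbar F) (j : ℕ) : Kbar F := z ^ qq F ^ j / emb F (DD F j)

/-- The Carlitz exponential. -/
def eC (z : Kbar F) : Kbar F := ∑' j, eCTerm z j

/-- The terms of the series `ρ(ζ) = ∑ (-1)^n ζ^(q^n) / L_n`. -/
def rhoTerm (z : Kbar F) (n : ℕ) : Kbar F := (-1) ^ n * z ^ qq F ^ n / emb F (LL F n)

/-- The function `ρ`, the inverse of the Carlitz exponential. -/
def rho (z : Kbar F) : Kbar F := ∑' n, rhoTerm z n

/-- A sequence `f` in `X` is an orthonormal basis (in the non-Archimedean sense): every `φ ∈ X` is in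
exactly one way the sum of a uniformly convergent series `∑ c_i f_i` with `c_i → 0`, and then
`‖φ‖ = sup |c_i|`. -/
def IsOrthonormalBasis (f : ℕ → XX F) : Prop :=
  ∀ φ : XX F,
    (∃! c : ℕ → Kbar F, Tendsto c atTop (𝓝 0) ∧ HasSum (fun i => c i • f i) φ) ∧
    ∀ c : ℕ → Kbar F, Tendsto c atTop (𝓝 0) → HasSum (fun i => c i • f i) φ →
      IsLUB (Set.range fun i => ‖c i‖) ‖φ‖

/-- The function `u(t) = a ∑ c^(q^n) f_n(t)`. -/
def coherent (f : ℕ → XX F) (a c : Kbar F) : XX F := a • ∑' n, c ^ qq F ^ n • f n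

variable (F) in
/-- The radius `q^(-1/(q-1))` of convergence of the Carlitz exponential. -/
def radC : ℝ := (qq F : ℝ) ^ (-(1 / ((qq F : ℝ) - 1)))

/-- `u` has the form `u(t) = a e_C(t z)` with `z = ρ(c)`, where `z` lies in the disc of convergence
of `e_C` and all the series that occur converge. -/
def HasExpForm (a c : Kbar F) (u : XX F) : Prop :=
  Summable (rhoTerm c) ∧ ‖rho c‖ < radC F ∧
    ∀ t : OO F, Summable (eCTerm (emb F t * rho c)) ∧ ev u t = a * eC (emb F t * rho c)

end Field

end CarlitzOscillator

end

open CarlitzOscillator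

noncomputable section

namespace CarlitzOscillator

/-! ## The `q`-power Frobenius -/

/-! The `q`-th power map is a continuous automorphism of `K̄` with continuous inverse, so `R_q` is
bijective on `X`. Identities for `a⁻` are checked after taking `q`-th powers, where only `Δ`
remains.

The action on Carlitz polynomials rests on two identities, `[i+1] f_{i+1} = f_i^q - f_i` and
`f_{i+1}(xt) = x f_{i+1}(t) + f_i(t)^q`. Both follow from `e_{i+1} = e_i^q - D_i^(q-1) e_i`, which
comes from grouping the roots of `e_{i+1}` by their coefficient of `x^i`.

A function in `X` is determined by its values at the powers of `x`. The matrix `f_i(x^j)` is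
unitriangular with integral entries, and its entries with `i < j` have norm at most `q⁻¹`. Solving
the triangular system therefore gives unique coefficients bounded by the sup norm, and the extra
`q⁻¹` forces them to tend to zero (`tendsto_coeffX`).

On coefficients `a⁻` is a shift followed by a `q`-th root, so `a⁻u = λu` becomes `c_{n+1} = λ^q
c_n^q`. A rescaling by a power of `λ^(1/(q-1))` solves this by `c^(q^n)`, which tends to zero
exactly when `|c| < 1`.

From `e_C(xz) = x e_C(z) + e_C(z)^q`, the function `t ↦ e_C(tz)` is fixed by `a⁻`, so its
coefficients are the powers `c^(q^n)` of its value `c` at `t = 1`. With `z = ρ(c)` this value is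
`c`, because `e_C ∘ ρ` is the identity on the disc (`eC_rho`). -/

theorem exists_prime_qq (F : Type*) [Field F] [Finite F] :
    ∃ p n : ℕ, p.Prime ∧ CharP F p ∧ qq F = p ^ n := by
  have := Fintype.ofFinite F
  obtain ⟨p, hp⟩ := CharP.exists F
  obtain ⟨n, hpp, hn⟩ := FiniteField.card F p
  exact ⟨p, n, hpp, hp, by rw [← hn]; exact Nat.card_eq_fintype_card⟩

section Frobenius

variable {F : Type*} [Field F] [Finite F] {R : Type*} [CommRing R]

theorem pow_qq (β : F) : β ^ qq F = β := by
  have := Fintype.ofFinite F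
  rw [qq, Nat.card_eq_fintype_card, FiniteField.pow_card]

theorem pow_qq_pow (β : F) (n : ℕ) : β ^ qq F ^ n = β := by
  induction n with
  | zero => simp
  | succ n ih => rw [pow_succ, pow_mul, ih, pow_qq]

theorem qq_pos : 0 < qq F := (one_lt_qq F).le

theorem qq_ne_zero : qq F ≠ 0 := qq_pos.ne'

theorem one_lt_qq_real : (1 : ℝ) < qq F := by exact_mod_cast one_lt_qq F

theorem qq_real_pos : (0 : ℝ) < qq F := zero_lt_one.trans one_lt_qq_real

/-- The map `a ↦ a ^ (q ^ n)` on an `F`-algebra. -/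
def frobPow [Nontrivial R] (i : F →+* R) (n : ℕ) : R →+* R where
  toFun a := a ^ qq F ^ n
  map_one' := one_pow _
  map_zero' := zero_pow (pow_ne_zero _ qq_ne_zero)
  map_mul' a b := mul_pow a b _
  map_add' a b := by
    obtain ⟨p, m, hp, hc, hq⟩ := exists_prime_qq F
    have : Fact p.Prime := ⟨hp⟩
    have : CharP R p := charP_of_injective_ringHom i.injective p
    rw [hq, ← pow_mul]
    exact add_pow_char_pow a b p (m * n)

@[simp] theorem frobPow_apply [Nontrivial R] (i : F →+* R) (n : ℕ) (a : R) :
    frobPow i n a = a ^ qq F ^ n := rfl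

/-- The elements of `F` are the roots of `X ^ q - X`. -/
theorem prod_sub_mul (i : F →+* R) [Fintype F] (y v : R) :
    ∏ β : F, (y - i β * v) = y ^ qq F - v ^ (qq F - 1) * y := by
  have h : ∏ β : F, (Polynomial.X - Polynomial.C β) = Polynomial.X ^ qq F - Polynomial.X := by
    rw [qq, Nat.card_eq_fintype_card]
    have hm := Polynomial.prod_multiset_X_sub_C_of_monic_of_roots_card_eq
      (p := (Polynomial.X ^ Fintype.card F - Polynomial.X : Polynomial F))
      (Polynomial.monic_X_pow_sub (by
        rw [Polynomial.degree_X]; exact_mod_cast Fintype.one_lt_card))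
      (by rw [FiniteField.roots_X_pow_card_sub_X, FiniteField.X_pow_card_sub_X_natDegree_eq F
            Fintype.one_lt_card]; rfl)
    rw [FiniteField.roots_X_pow_card_sub_X] at hm
    exact hm
  -- In a general `R` one cannot divide by `v`. The homogeneous identity is proved for
  -- indeterminates, by substituting `Y / V` in the fraction field, and then specialised.
  have hh : ∏ β : F, (MvPolynomial.X 0 - MvPolynomial.C β * MvPolynomial.X 1) =
      (MvPolynomial.X 0 ^ qq F - MvPolynomial.X 1 ^ (qq F - 1) * MvPolynomial.X 0 :
        MvPolynomial (Fin 2) F) := by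
    set Y : MvPolynomial (Fin 2) F := MvPolynomial.X 0
    set V : MvPolynomial (Fin 2) F := MvPolynomial.X 1
    let j : MvPolynomial (Fin 2) F →+* FractionRing (MvPolynomial (Fin 2) F) := algebraMap _ _
    have hj : Function.Injective j := IsFractionRing.injective _ _
    have hV : j V ≠ 0 := by
      rw [Ne, map_eq_zero_iff j hj]; exact MvPolynomial.X_ne_zero 1
    apply hj
    have h2 := congrArg (Polynomial.eval₂ (j.comp MvPolynomial.C) (j Y / j V)) h
    simp only [Polynomial.eval₂_finsetProd, Polynomial.eval₂_sub, Polynomial.eval₂_X,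
      Polynomial.eval₂_C, Polynomial.eval₂_pow] at h2
    have h3 : ∀ β : F, j (Y - MvPolynomial.C β * V) =
        j V * (j Y / j V - j.comp MvPolynomial.C β) := fun β => by
      rw [map_sub, map_mul, RingHom.comp_apply]; field_simp
    rw [map_prod, Finset.prod_congr rfl fun β _ => h3 β, Finset.prod_mul_distrib, h2,
      Finset.prod_const, Finset.card_univ, ← Nat.card_eq_fintype_card, div_pow, mul_sub,
      mul_div_cancel₀ _ (pow_ne_zero _ hV), map_sub, map_mul, map_pow, map_pow,
      ← pow_sub_one_mul qq_ne_zero (j V)]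
    congr 1
    field_simp
  have h2 := congrArg (MvPolynomial.eval₂Hom i ![y, v]) hh
  simpa using h2

end Frobenius

/-! ### Roots of order `q` and `q - 1` in `K̄` -/

section Kbar

variable (F : Type*) [Field F] [Finite F]

theorem isUltrametricDist_Kac : IsUltrametricDist (Kac F) :=
  IsUltrametricDist.of_normedAlgebra (KK F)

attribute [local instance] isUltrametricDist_Kac in
theorem isUltrametricDist_Kbar : IsUltrametricDist (Kbar F) :=
  IsUltrametricDist.of_normedAlgebra (Kac F)

attribute [local instance] isUltrametricDist_Kbar

/-- The map `z ↦ z ^ (q ^ n)` on `K̄`. -/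
abbrev frob (n : ℕ) : Kbar F →+* Kbar F := frobPow (cbar F) n

variable {F}

/-- Additivity of Frobenius gives `d(g a, g b)^q = d(a, b)` for the `q`-th root `g` on the algebraic
closure. So `g` is uniformly continuous and extends to the completion. -/
theorem exists_pow_qq_eq (z : Kbar F) : ∃ w : Kbar F, w ^ qq F = z := by
  let j : F →+* Kac F := (algebraMap (KK F) (Kac F)).comp HahnSeries.C
  choose g hg using fun a : Kac F => IsAlgClosed.exists_pow_nat_eq a (qq_pos (F := F))
  have hpow : ∀ a : Kac F, ((g a : Kac F) : Kbar F) ^ qq F = a := fun a => by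
    have h := map_pow (UniformSpace.Completion.coeRingHom : Kac F →+* Kbar F) (g a) (qq F)
    rw [hg] at h
    exact h.symm
  have hd : ∀ a b, dist (g a) (g b) ^ qq F = dist a b := fun a b => by
    rw [dist_eq_norm, dist_eq_norm, ← norm_pow]
    congr 1
    have h := map_sub (frobPow j 1) (g a) (g b)
    simp only [frobPow_apply, pow_one, hg] at h
    exact h
  have hu : UniformContinuous g := by
    refine Metric.uniformContinuous_iff.2 fun ε hε => ⟨ε ^ qq F, pow_pos hε _, fun {a b} h => ?_⟩
    rw [← hd] at h
    exact lt_of_pow_lt_pow_left₀ _ hε.le h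
  refine ⟨UniformSpace.Completion.map g z, ?_⟩
  induction z using UniformSpace.Completion.induction_on with
  | hp => exact isClosed_eq (UniformSpace.Completion.continuous_map.pow _) continuous_id
  | ih a => rw [UniformSpace.Completion.map_coe hu, hpow]

theorem frob_bijective : Function.Bijective (frob F 1) :=
  ⟨(frob F 1).injective, fun z => by
    obtain ⟨w, hw⟩ := exists_pow_qq_eq z
    exact ⟨w, by simpa using hw⟩⟩

/-- The `q`-th root on `K̄`. -/
def rt : Kbar F ≃+* Kbar F := (RingEquiv.ofBijective (frob F 1) frob_bijective).symm

@[simp] theorem rt_pow (z : Kbar F) : rt z ^ qq F = z := by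
  have h := (RingEquiv.ofBijective (frob F 1) frob_bijective).apply_symm_apply z
  rw [RingEquiv.ofBijective_apply, frobPow_apply, pow_one] at h
  exact h

theorem rt_eq_of_pow_eq {z w : Kbar F} (h : w ^ qq F = z) : rt z = w :=
  frob_bijective.1 (by simp [h])

theorem norm_rt_pow (z : Kbar F) : ‖rt z‖ ^ qq F = ‖z‖ := by rw [← norm_pow, rt_pow]

theorem continuous_rt : Continuous (rt : Kbar F → Kbar F) := by
  refine continuous_of_continuousAt_zero (rt : Kbar F ≃+* Kbar F) ?_
  refine Metric.continuousAt_iff.2 fun ε hε => ⟨ε ^ qq F, pow_pos hε _, fun {a} h => ?_⟩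
  rw [map_zero, dist_zero_right]
  rw [dist_zero_right, ← norm_rt_pow] at h
  exact lt_of_pow_lt_pow_left₀ _ hε.le h

/-- The infinite product `s = ∏ w^(q^j)` converges because `w^(q^n) - 1 = (w - 1)^(q^n)`. It
satisfies `s = w s^q`, so `s⁻¹` is the root. -/
theorem exists_pow_qq_sub_one_eq_of_norm_sub_lt {w : Kbar F} (hw : ‖w - 1‖ < 1) :
    ∃ s : Kbar F, s ^ (qq F - 1) = w := by
  have hw1 : ‖w‖ = 1 := by
    have := IsUltrametricDist.norm_eq_of_add_norm_lt_max (x := w) (y := -1)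
      (by rw [norm_neg, norm_one, ← sub_eq_add_neg]; exact lt_max_of_lt_right hw)
    simpa using this
  have hw0 : w ≠ 0 := by rw [← norm_ne_zero_iff, hw1]; exact one_ne_zero
  let P : ℕ → Kbar F := fun n => ∏ j ∈ Finset.range n, w ^ qq F ^ j
  have hP : ∀ n, ‖P n‖ = 1 := fun n => by simp [P, hw1]
  have hsub : ∀ n, w ^ qq F ^ n - 1 = (w - 1) ^ qq F ^ n := fun n => by
    have := map_sub (frob F n) w 1
    simpa using this.symm
  have hlim : Tendsto (fun n => (w - 1) ^ qq F ^ n) atTop (𝓝 0) :=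
    (tendsto_pow_atTop_nhds_zero_of_norm_lt_one hw).comp
      (tendsto_pow_atTop_atTop_of_one_lt (one_lt_qq F))
  have hc : CauchySeq P := by
    refine cauchySeq_of_le_geometric ‖w - 1‖ 1 hw fun n => ?_
    rw [dist_comm, dist_eq_norm]
    have hs : P (n + 1) = P n * w ^ qq F ^ n := Finset.prod_range_succ _ _
    rw [hs, ← mul_sub_one, norm_mul, hP, hsub, norm_pow, one_mul, one_mul]
    exact pow_le_pow_of_le_one (norm_nonneg _) hw.le (Nat.lt_pow_self (one_lt_qq F)).le
  obtain ⟨s, hs⟩ := cauchySeq_tendsto_of_complete hc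
  have hs1 : ‖s‖ = 1 := tendsto_nhds_unique hs.norm (by simpa only [hP] using tendsto_const_nhds)
  have hs0 : s ≠ 0 := by rw [← norm_ne_zero_iff, hs1]; exact one_ne_zero
  have hrec : ∀ n, P (n + 1) = w * P n ^ qq F := fun n => by
    simp only [P]
    rw [Finset.prod_range_succ', ← Finset.prod_pow, pow_zero, pow_one, mul_comm]
    simp only [← pow_mul, ← pow_succ]
  have heq : s = w * s ^ qq F := tendsto_nhds_unique ((tendsto_add_atTop_iff_nat 1).2 hs)
    (by simpa only [hrec] using (hs.pow (qq F)).const_mul w)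
  refine ⟨s⁻¹, ?_⟩
  rw [inv_pow]
  rw [← pow_sub_one_mul qq_ne_zero] at heq
  exact inv_eq_of_mul_eq_one_right (mul_right_cancel₀ hs0 (by linear_combination -heq))

theorem exists_pow_qq_sub_one_eq (l : Kbar F) : ∃ s : Kbar F, s ^ (qq F - 1) = l := by
  have hq : 0 < qq F - 1 := Nat.sub_pos_of_lt (one_lt_qq F)
  rcases eq_or_ne l 0 with rfl | hl
  · exact ⟨0, zero_pow hq.ne'⟩
  -- An algebraic `a` with `|l - a| < |l|` has `|a| = |l|`, so `l / a` lies in the open unit disc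
  -- about `1`; `a` itself has a root in the algebraic closure.
  obtain ⟨a, ha⟩ := UniformSpace.Completion.denseRange_coe.exists_dist_lt l (norm_pos_iff.2 hl)
  obtain ⟨b, hb⟩ := IsAlgClosed.exists_pow_nat_eq a hq
  have hb' : (b : Kbar F) ^ (qq F - 1) = a := by
    have h := map_pow (UniformSpace.Completion.coeRingHom : Kac F →+* Kbar F) b (qq F - 1)
    rw [hb] at h
    exact h.symm
  have han : ‖(a : Kbar F)‖ = ‖l‖ := by
    rw [dist_eq_norm] at ha
    have := IsUltrametricDist.norm_eq_of_add_norm_lt_max (x := l) (y := -(a : Kbar F))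
      (by rw [← sub_eq_add_neg]; exact lt_max_of_lt_left ha)
    simpa using this.symm
  have ha0 : (a : Kbar F) ≠ 0 := by rw [← norm_ne_zero_iff, han]; exact norm_ne_zero_iff.2 hl
  obtain ⟨s, hs⟩ := exists_pow_qq_sub_one_eq_of_norm_sub_lt (w := l / (a : Kbar F)) (by
    rw [div_sub_one ha0, norm_div, han, div_lt_one (norm_pos_iff.2 hl), ← dist_eq_norm]
    exact ha)
  refine ⟨(b : Kbar F) * s, ?_⟩
  rw [mul_pow, hs, hb', mul_div_cancel₀ _ ha0]

end Kbar

attribute [local instance] isUltrametricDist_Kbar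

/-! ## The operators `R_q`, `Δ`, `a⁺`, `a⁻` -/

section Operators

variable {F : Type*} [Field F] [Finite F]

theorem XX_ext {u v : XX F} (h : ∀ t, ev u t = ev v t) : u = v :=
  Subtype.ext (ContinuousMap.ext h)

@[simp] theorem ev_zero (t : OO F) : ev (0 : XX F) t = 0 := rfl

@[simp] theorem ev_add (u v : XX F) (t : OO F) : ev (u + v) t = ev u t + ev v t := rfl

@[simp] theorem ev_sub (u v : XX F) (t : OO F) : ev (u - v) t = ev u t - ev v t := rfl

@[simp] theorem ev_smul (c : Kbar F) (u : XX F) (t : OO F) : ev (c • u) t = c * ev u t := rfl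

@[simp] theorem ev_Rq (u : XX F) (t : OO F) : ev (Rq u) t = ev u t ^ qq F := rfl

@[simp] theorem ev_Delta (u : XX F) (t : OO F) :
    ev (Delta u) t = ev u (xO F * t) - emb F (xO F) * ev u t := rfl

theorem ev_add_right (u : XX F) (s t : OO F) : ev u (s + t) = ev u s + ev u t := u.2.1 s t

theorem ev_cO_mul (u : XX F) (β : F) (t : OO F) : ev u (cO F β * t) = cbar F β * ev u t :=
  u.2.2 β t

theorem norm_ev_le (u : XX F) (t : OO F) : ‖ev u t‖ ≤ ‖u‖ := u.1.norm_coe_le_norm t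

theorem norm_XX_le {u : XX F} {C : ℝ} (hC : 0 ≤ C) (h : ∀ t, ‖ev u t‖ ≤ C) : ‖u‖ ≤ C :=
  (ContinuousMap.norm_le u.1 hC).2 h

/-- Evaluation at a point, as a continuous linear map. -/
def evL (t : OO F) : XX F →L[Kbar F] Kbar F where
  toFun u := ev u t
  map_add' _ _ := rfl
  map_smul' _ _ := rfl
  cont := (ContinuousEvalConst.continuous_eval_const t).comp continuous_subtype_val

theorem add_pow_qq (a b : Kbar F) : (a + b) ^ qq F = a ^ qq F + b ^ qq F := by
  simpa using map_add (frob F 1) a b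

theorem sub_pow_qq (a b : Kbar F) : (a - b) ^ qq F = a ^ qq F - b ^ qq F := by
  simpa using map_sub (frob F 1) a b

theorem cbar_pow_qq (β : F) : cbar F β ^ qq F = cbar F β := by rw [← map_pow, pow_qq]

theorem rt_cbar (β : F) : rt (cbar F β) = cbar F β := rt_eq_of_pow_eq (cbar_pow_qq β)

theorem Rq_add (u v : XX F) : Rq (u + v) = Rq u + Rq v := XX_ext fun t => by simp [add_pow_qq]

theorem Rq_smul (c : Kbar F) (u : XX F) : Rq (c • u) = c ^ qq F • Rq u :=
  XX_ext fun t => by simp [mul_pow]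

theorem Delta_add (u v : XX F) : Delta (u + v) = Delta u + Delta v :=
  XX_ext fun t => by simp; ring

theorem Delta_smul (c : Kbar F) (u : XX F) : Delta (c • u) = c • Delta u :=
  XX_ext fun t => by simp; ring

/-- The `q`-th root of an element of `X`. -/
def rootX (u : XX F) : XX F :=
  ⟨⟨fun t => rt (ev u t), continuous_rt.comp u.1.continuous⟩,
    fun s t => by simp [ev_add_right], fun β t => by simp [ev_cO_mul, rt_cbar]⟩

@[simp] theorem ev_rootX (u : XX F) (t : OO F) : ev (rootX u) t = rt (ev u t) := rfl

theorem Rq_rootX (u : XX F) : Rq (rootX u) = u := XX_ext fun t => by simp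

theorem Rq_injective : Function.Injective (Rq : XX F → XX F) := fun u v h =>
  XX_ext fun t => frob_bijective.1 (by simpa using congrArg (fun w => ev w t) h)

theorem mem_range_Rq (u : XX F) : u ∈ Set.range (Rq : XX F → XX F) := ⟨rootX u, Rq_rootX u⟩

theorem Rq_aMinus (u : XX F) : Rq (aMinus u) = Delta u :=
  Function.invFun_eq (mem_range_Rq (Delta u))

theorem aMinus_eq_iff {u v : XX F} : aMinus u = v ↔ Rq v = Delta u :=
  ⟨fun h => h ▸ Rq_aMinus u, fun h => Rq_injective ((Rq_aMinus u).trans h.symm)⟩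

theorem aMinus_eq_rootX (u : XX F) : aMinus u = rootX (Delta u) :=
  aMinus_eq_iff.2 (Rq_rootX _)

theorem aMinus_add (u v : XX F) : aMinus (u + v) = aMinus u + aMinus v :=
  aMinus_eq_iff.2 (by rw [Rq_add, Rq_aMinus, Rq_aMinus, Delta_add])

theorem aMinus_smul (c : Kbar F) (u : XX F) : aMinus (c • u) = rt c • aMinus u :=
  aMinus_eq_iff.2 (by rw [Rq_smul, Rq_aMinus, rt_pow, Delta_smul])

/-- The operator `a⁻` as a homomorphism of additive groups. -/
def aMinusHom : XX F →+ XX F := AddMonoidHom.mk' aMinus aMinus_add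

theorem aPlus_add (u v : XX F) : aPlus (u + v) = aPlus u + aPlus v := by
  simp only [aPlus, Rq_add]; abel

theorem isFLinear_aPlus : IsFLinear (aPlus : XX F → XX F) :=
  ⟨aPlus_add, fun β u => by simp only [aPlus, Rq_smul, cbar_pow_qq, smul_sub]⟩

theorem isFLinear_aMinus : IsFLinear (aMinus : XX F → XX F) :=
  ⟨aMinus_add, fun β u => by rw [aMinus_smul, rt_cbar]⟩

theorem continuous_aPlus : Continuous (aPlus : XX F → XX F) := by
  refine Continuous.sub ?_ continuous_id
  exact Continuous.subtype_mk (continuous_subtype_val.pow _) _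

theorem norm_xO_le_one : ‖emb F (xO F)‖ ≤ 1 := by
  rw [norm_emb]; exact (mem_OO F _).1 (xO F).2

theorem norm_Delta_le (u : XX F) : ‖Delta u‖ ≤ ‖u‖ := by
  refine norm_XX_le (norm_nonneg _) fun t => ?_
  rw [ev_Delta, sub_eq_add_neg]
  refine (IsUltrametricDist.norm_add_le_max _ _).trans (max_le (norm_ev_le _ _) ?_)
  rw [norm_neg, norm_mul]
  exact (mul_le_of_le_one_left (norm_nonneg _) norm_xO_le_one).trans (norm_ev_le _ _)

theorem continuous_aMinus : Continuous (aMinus : XX F → XX F) := by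
  refine continuous_of_continuousAt_zero (aMinusHom : XX F →+ XX F) ?_
  -- Pointwise `|a⁻u|^q = |Δu| ≤ ‖u‖`. Passing to the supremum loses strictness, hence `ε / 2`.
  refine Metric.continuousAt_iff.2 fun ε hε =>
    ⟨(ε / 2) ^ qq F, pow_pos (half_pos hε) _, fun {u} hu => ?_⟩
  rw [map_zero, dist_zero_right]
  rw [dist_zero_right] at hu
  refine lt_of_le_of_lt ?_ (half_lt_self hε)
  refine norm_XX_le (half_pos hε).le fun t => ?_
  change ‖ev (aMinus u) t‖ ≤ _
  rw [aMinus_eq_rootX, ev_rootX]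
  refine le_of_pow_le_pow_left₀ (qq_ne_zero (F := F)) (half_pos hε).le ?_
  rw [norm_rt_pow]
  exact ((norm_ev_le _ _).trans (norm_Delta_le u)).trans hu.le

/-- After taking `q`-th powers the claim reduces to `Δ(u^q) - (Δu)^q = (x^q - x) u^q`; the
contributions of `-I` cancel. -/
theorem commutator (u : XX F) :
    aMinus (aPlus u) - aPlus (aMinus u) = rt (emb F (br F 1)) • u := by
  have h : aMinus (aPlus u) = aPlus (aMinus u) + rt (emb F (br F 1)) • u := by
    refine aMinus_eq_iff.2 (XX_ext fun t => ?_)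
    have h1 : ∀ t, ev (aMinus u) t ^ qq F = ev u (xO F * t) - emb F (xO F) * ev u t := fun t => by
      rw [← ev_Rq, Rq_aMinus, ev_Delta]
    simp only [aPlus, ev_Rq, ev_add, ev_sub, ev_smul, ev_Delta, add_pow_qq, sub_pow_qq, mul_pow,
      rt_pow, h1, br, map_sub, map_pow, pow_one]
    ring
  rw [h, add_sub_cancel_left]

end Operators

/-! ## Carlitz polynomials -/

section Carlitz

theorem polyK_add {F : Type*} [Field F] (m n : Polynomial F) :
    polyK F (m + n) = polyK F m + polyK F n := by
  simp [polyK]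

variable (F : Type*) [Field F] [Finite F]

theorem norm_xO : ‖(xO F : KK F)‖ = (qq F : ℝ)⁻¹ := by
  have h : (xO F : KK F) = HahnSeries.single (1 : ℤ) (1 : F) := HahnSeries.ofPowerSeries_X
  rw [h, norm_single, zpow_neg_one]

theorem norm_br {i : ℕ} (hi : 1 ≤ i) : ‖br F i‖ = (qq F : ℝ)⁻¹ := by
  have h1 : (qq F : ℝ)⁻¹ < 1 := inv_lt_one_of_one_lt₀ one_lt_qq_real
  have h0 : (0 : ℝ) < (qq F : ℝ)⁻¹ := inv_pos.2 qq_real_pos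
  have hlt : ‖(xO F : KK F) ^ qq F ^ i‖ < ‖-(xO F : KK F)‖ := by
    rw [norm_neg, norm_pow, norm_xO]
    exact pow_lt_self_of_lt_one₀ h0 h1 (Nat.one_lt_pow (by lia) (one_lt_qq F))
  rw [br, sub_eq_add_neg, IsUltrametricDist.norm_add_eq_max_of_norm_ne_norm hlt.ne,
    max_eq_right hlt.le, norm_neg, norm_xO]

theorem br_ne_zero {i : ℕ} (hi : 1 ≤ i) : br F i ≠ 0 := by
  rw [← norm_ne_zero_iff, norm_br F hi]; exact inv_ne_zero qq_real_pos.ne'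

theorem br_zero : br F 0 = 0 := by simp [br]

@[simp] theorem DD_zero : DD F 0 = 1 := by simp [DD]

@[simp] theorem LL_zero : LL F 0 = 1 := by simp [LL]

theorem DD_succ (i : ℕ) : DD F (i + 1) = br F (i + 1) * DD F i ^ qq F := by
  rw [DD, Finset.prod_range_succ', DD, ← Finset.prod_pow, mul_comm]
  simp only [pow_zero, pow_one, Nat.sub_zero, Nat.add_sub_add_right, ← pow_mul, ← pow_succ]

theorem LL_succ (i : ℕ) : LL F (i + 1) = br F (i + 1) * LL F i := by
  rw [LL, Finset.prod_range_succ', LL, mul_comm]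
  simp only [Nat.sub_zero, Nat.add_sub_add_right]

theorem DD_ne_zero (i : ℕ) : DD F i ≠ 0 := by
  induction i with
  | zero => simp
  | succ i ih => rw [DD_succ]; exact mul_ne_zero (br_ne_zero F (by lia)) (pow_ne_zero _ ih)

theorem norm_LL (n : ℕ) : ‖LL F n‖ = ((qq F : ℝ)⁻¹) ^ n := by
  induction n with
  | zero => simp
  | succ n ih => rw [LL_succ, norm_mul, ih, norm_br F (by lia), pow_succ']

/-- The polynomials `e_i` by recursion. -/
def eeRec : ℕ → KK F → KK F
  | 0, t => t
  | i + 1, t => eeRec i t ^ qq F - DD F i ^ (qq F - 1) * eeRec i t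

variable {F}

/-- The constants in `K`. -/
abbrev cK : F →+* KK F := HahnSeries.C

theorem add_pow_qq_K (a b : KK F) : (a + b) ^ qq F = a ^ qq F + b ^ qq F := by
  simpa using map_add (frobPow (cK (F := F)) 1) a b

theorem sub_pow_qq_K (a b : KK F) : (a - b) ^ qq F = a ^ qq F - b ^ qq F := by
  simpa using map_sub (frobPow (cK (F := F)) 1) a b

theorem eeRec_add (i : ℕ) (s t : KK F) : eeRec F i (s + t) = eeRec F i s + eeRec F i t := by
  induction i with
  | zero => rfl
  | succ i ih => simp only [eeRec, ih, add_pow_qq_K]; ring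

theorem eeRec_smul (i : ℕ) (β : F) (t : KK F) : eeRec F i (cK β * t) = cK β * eeRec F i t := by
  induction i with
  | zero => rfl
  | succ i ih => simp only [eeRec, ih, mul_pow, ← map_pow, pow_qq]; ring

theorem br_pow_add (i : ℕ) : br F i ^ qq F + br F 1 = br F (i + 1) := by
  simp only [br, sub_pow_qq_K, ← pow_mul, ← pow_succ, pow_one]; ring

theorem eeRec_xO_mul (i : ℕ) (t : KK F) :
    eeRec F (i + 1) (xO F * t) =
      xO F * eeRec F (i + 1) t + br F (i + 1) * eeRec F i t ^ qq F := by
  induction i with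
  | zero => simp only [eeRec, DD_zero, br, mul_pow, one_pow, zero_add, pow_one]; ring
  | succ i ih =>
    have hb := br_pow_add (F := F) (i + 1)
    -- This makes the terms in `e_i(t)^q` cancel. The terms in `e_{i+1}(t)^q` combine through
    -- `[i+1]^q + [1] = [i+2]`.
    have hD : DD F (i + 1) ^ (qq F - 1) * br F (i + 1) =
        br F (i + 1) ^ qq F * (DD F i ^ (qq F - 1)) ^ qq F := by
      rw [DD_succ, mul_pow, mul_right_comm, pow_sub_one_mul qq_ne_zero, ← pow_mul, ← pow_mul,
        mul_comm (qq F)]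
    have he : eeRec F i t ^ qq F = eeRec F (i + 1) t + DD F i ^ (qq F - 1) * eeRec F i t := by
      simp only [eeRec]; ring
    have he' : (eeRec F i t ^ qq F) ^ qq F = eeRec F (i + 1) t ^ qq F +
        (DD F i ^ (qq F - 1)) ^ qq F * eeRec F i t ^ qq F := by
      conv_lhs => rw [he, add_pow_qq_K, mul_pow]
    have h1 : ∀ t, eeRec F (i + 1 + 1) t =
      eeRec F (i + 1) t ^ qq F - DD F (i + 1) ^ (qq F - 1) * eeRec F (i + 1) t := fun _ => rfl
    rw [h1, h1, ih, add_pow_qq_K, mul_pow, mul_pow, he', ← hb]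
    have hb1 : br F 1 = (xO F : KK F) ^ qq F - xO F := by rw [br, pow_one]
    rw [hb1]
    linear_combination (-(eeRec F i t ^ qq F)) * hD

theorem eeRec_xO_pow (i : ℕ) : eeRec F i ((xO F : KK F) ^ i) = DD F i := by
  induction i with
  | zero => simp [eeRec]
  | succ i ih =>
    have h0 : eeRec F (i + 1) ((xO F : KK F) ^ i) = 0 := by
      rw [eeRec, ih, pow_sub_one_mul qq_ne_zero, sub_self]
    rw [pow_succ', eeRec_xO_mul, h0, ih, DD_succ, mul_zero, zero_add]

theorem finite_degree_lt (i : ℕ) : {m : Polynomial F | m.degree < (i : WithBot ℕ)}.Finite := by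
  have : Finite (Polynomial.degreeLT F i) :=
    Finite.of_equiv _ (Polynomial.degreeLTEquiv F i).symm.toEquiv
  exact (Set.toFinite (Polynomial.degreeLT F i : Set (Polynomial F))).subset
    fun m hm => Polynomial.mem_degreeLT.2 hm

theorem ee_eq_prod (i : ℕ) (t : KK F) :
    ee F i t = ∏ m ∈ (finite_degree_lt (F := F) i).toFinset, (t - polyK F m) :=
  finprod_mem_eq_finite_toFinset_prod _ _

theorem polyK_C_mul_X_pow (β : F) (i : ℕ) :
    polyK F (Polynomial.C β * Polynomial.X ^ i) = cK β * (xO F : KK F) ^ i := by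
  simp [polyK, xO]

theorem ee_zero (t : KK F) : ee F 0 t = t := by
  have h : (finite_degree_lt (F := F) 0).toFinset = {0} := by
    ext m; simp [Polynomial.degree_eq_bot]
  rw [ee_eq_prod, h, Finset.prod_singleton]
  simp [polyK]

/-- Each `m` of degree less than `i + 1` splits uniquely as `βx^i` plus a polynomial of degree less
than `i`. -/
theorem ee_succ [Fintype F] (i : ℕ) (t : KK F) :
    ee F (i + 1) t = ∏ β : F, ee F i (t - cK β * (xO F : KK F) ^ i) := by
  simp only [ee_eq_prod]
  rw [← Finset.prod_product']
  symm
  refine Finset.prod_nbij' (fun p => p.2 + Polynomial.C p.1 * Polynomial.X ^ i)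
    (fun m => (m.coeff i, m - Polynomial.C (m.coeff i) * Polynomial.X ^ i)) ?_ ?_ ?_ ?_ ?_
  · rintro ⟨β, m⟩ h
    simp only [Finset.mem_product, Finset.mem_univ, true_and, Set.Finite.mem_toFinset,
      Set.mem_ofPred_eq] at h ⊢
    refine lt_of_le_of_lt (Polynomial.degree_add_le _ _) (max_lt ?_ ?_)
    · exact h.trans (by exact_mod_cast i.lt_succ_self)
    · exact (Polynomial.degree_C_mul_X_pow_le _ _).trans_lt (by exact_mod_cast i.lt_succ_self)
  · intro m h
    simp only [Finset.mem_product, Finset.mem_univ, true_and, Set.Finite.mem_toFinset,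
      Set.mem_ofPred_eq] at h ⊢
    rw [Polynomial.degree_lt_iff_coeff_zero] at h ⊢
    intro k hk
    rw [Polynomial.coeff_sub, Polynomial.coeff_C_mul_X_pow]
    split_ifs with hki
    · rw [hki, sub_self]
    · rw [h k (by lia), sub_zero]
  · rintro ⟨β, m⟩ h
    simp only [Finset.mem_product, Finset.mem_univ, true_and, Set.Finite.mem_toFinset,
      Set.mem_ofPred_eq] at h
    rw [Polynomial.degree_lt_iff_coeff_zero] at h
    simp [h i le_rfl]
  · intro m _
    simp
  · rintro ⟨β, m⟩ _
    rw [polyK_add, polyK_C_mul_X_pow]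
    ring

/-- By linearity and `e_i(x^i) = D_i`, the factors of `e_{i+1}(t)` are `e_i(t) - βD_i`; their
product over `β` is given by `prod_sub_mul`. -/
theorem ee_eq_eeRec (i : ℕ) (t : KK F) : ee F i t = eeRec F i t := by
  have := Fintype.ofFinite F
  induction i generalizing t with
  | zero => exact ee_zero t
  | succ i ih =>
    have h : ∀ β : F, ee F i (t - cK β * (xO F : KK F) ^ i) =
        eeRec F i t - cK β * DD F i := fun β => by
      have h1 := eeRec_add i (t - cK β * (xO F : KK F) ^ i) (cK β * (xO F : KK F) ^ i)
      rw [sub_add_cancel, eeRec_smul, eeRec_xO_pow] at h1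
      rw [ih, h1, add_sub_cancel_right]
    rw [ee_succ, Finset.prod_congr rfl fun β _ => h β, prod_sub_mul, eeRec]

theorem ff_eq (i : ℕ) (t : KK F) : ff F i t = (DD F i)⁻¹ * eeRec F i t := by
  rw [ff, ee_eq_eeRec]

theorem ff_zero (t : KK F) : ff F 0 t = t := by simp [ff_eq, eeRec]

theorem ff_add (i : ℕ) (s t : KK F) : ff F i (s + t) = ff F i s + ff F i t := by
  simp only [ff_eq, eeRec_add, mul_add]

theorem ff_smul (i : ℕ) (β : F) (t : KK F) : ff F i (cK β * t) = cK β * ff F i t := by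
  simp only [ff_eq, eeRec_smul]; ring

theorem br_mul_ff_succ (i : ℕ) (t : KK F) :
    br F (i + 1) * ff F (i + 1) t = ff F i t ^ qq F - ff F i t := by
  have hb := br_ne_zero F (i := i + 1) (by lia)
  have hD := DD_ne_zero F i
  simp only [ff_eq, eeRec, DD_succ]
  rw [← pow_sub_one_mul qq_ne_zero (DD F i), mul_pow, inv_pow,
    ← pow_sub_one_mul qq_ne_zero (DD F i)]
  field_simp

theorem ff_succ_xO_mul (i : ℕ) (t : KK F) :
    ff F (i + 1) (xO F * t) = xO F * ff F (i + 1) t + ff F i t ^ qq F := by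
  have hb := br_ne_zero F (i := i + 1) (by lia)
  have hD := DD_ne_zero F i
  simp only [ff_eq, eeRec_xO_mul, DD_succ, mul_pow, inv_pow]
  field_simp

theorem ff_xO_pow_self (i : ℕ) : ff F i ((xO F : KK F) ^ i) = 1 := by
  rw [ff_eq, eeRec_xO_pow, inv_mul_cancel₀ (DD_ne_zero F i)]

theorem ff_xO_pow_of_lt {i j : ℕ} (h : j < i) : ff F i ((xO F : KK F) ^ j) = 0 := by
  induction i with
  | zero => lia
  | succ i ih =>
    have h1 := br_mul_ff_succ i ((xO F : KK F) ^ j)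
    have h2 : ff F i ((xO F : KK F) ^ j) ^ qq F - ff F i ((xO F : KK F) ^ j) = 0 := by
      rcases (Nat.lt_succ_iff.1 h).lt_or_eq with hj | rfl
      · rw [ih hj, zero_pow qq_ne_zero, sub_zero]
      · rw [ff_xO_pow_self, one_pow, sub_self]
    rw [h2] at h1
    exact (mul_eq_zero.1 h1).resolve_left (br_ne_zero F (by lia))

/-- The constant term of `y` lies in `F` and is fixed by the `q`-th power, so `x` divides `y^q - y`.
-/
theorem norm_pow_qq_sub_le {y : KK F} (hy : ‖y‖ ≤ 1) : ‖y ^ qq F - y‖ ≤ (qq F : ℝ)⁻¹ := by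
  obtain ⟨f, rfl⟩ := (LaurentSeries.val_le_one_iff_eq_coe F y).1
    (Valued.toNormedField.norm_le_one_iff.1 hy)
  have hd : (PowerSeries.X : PowerSeries F) ∣ f ^ qq F - f := by
    rw [PowerSeries.X_dvd_iff, map_sub, map_pow, pow_qq, sub_self]
  obtain ⟨g, hg⟩ := hd
  rw [← map_pow, ← map_sub, hg, map_mul, norm_mul]
  have hg1 := (mem_OO F _).1 (powerSeries_mem F g)
  have hx := norm_xO F
  change ‖HahnSeries.ofPowerSeries ℤ F PowerSeries.X‖ = _ at hx
  rw [hx]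
  exact mul_le_of_le_one_right (inv_nonneg.2 qq_real_pos.le) hg1

/-- The factor `q⁻¹` gained in `f_i^q - f_i` exactly pays for dividing by `[i+1]`. -/
theorem norm_ff_le (i : ℕ) {t : KK F} (ht : ‖t‖ ≤ 1) : ‖ff F i t‖ ≤ 1 := by
  induction i with
  | zero => rwa [ff_zero]
  | succ i ih =>
    have h := norm_pow_qq_sub_le ih
    rw [← br_mul_ff_succ, norm_mul, norm_br F (by lia)] at h
    exact le_of_mul_le_mul_left (by rwa [mul_one]) (inv_pos.2 qq_real_pos)

theorem norm_ff_xO_pow_le {i j : ℕ} (h : i < j) :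
    ‖ff F i ((xO F : KK F) ^ j)‖ ≤ (qq F : ℝ)⁻¹ := by
  have h1 : (qq F : ℝ)⁻¹ < 1 := inv_lt_one_of_one_lt₀ one_lt_qq_real
  have h0 : (0 : ℝ) < (qq F : ℝ)⁻¹ := inv_pos.2 qq_real_pos
  have hx : ∀ k, ‖(xO F : KK F) ^ k‖ ≤ 1 := fun k => by
    rw [norm_pow, norm_xO]; exact pow_le_one₀ h0.le h1.le
  induction i generalizing j with
  | zero =>
    rw [ff_zero, norm_pow, norm_xO]
    exact pow_le_of_le_one h0.le h1.le (by lia)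
  | succ i ih =>
    obtain ⟨j, rfl⟩ : ∃ k, j = k + 1 := ⟨j - 1, by lia⟩
    rw [pow_succ', ff_succ_xO_mul]
    refine (IsUltrametricDist.norm_add_le_max _ _).trans (max_le ?_ ?_)
    · rw [norm_mul, norm_xO]
      exact mul_le_of_le_one_right h0.le (norm_ff_le _ (hx j))
    · rw [norm_pow]
      have := ih (j := j) (by lia)
      exact (pow_le_of_le_one (norm_nonneg _) (this.trans h1.le) qq_ne_zero).trans this

theorem continuous_eeRec (i : ℕ) : Continuous (eeRec F i) := by
  induction i with
  | zero => exact continuous_id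
  | succ i ih => exact (ih.pow _).sub (continuous_const.mul ih)

theorem continuous_ff (i : ℕ) : Continuous (ff F i) := by
  have h : ff F i = fun t => (DD F i)⁻¹ * eeRec F i t := funext (ff_eq i)
  rw [h]
  exact continuous_const.mul (continuous_eeRec i)

theorem continuous_emb : Continuous (emb F) :=
  (AddMonoidHomClass.isometry_of_norm (emb F) (norm_emb F)).continuous

/-- The Carlitz polynomials as elements of `X`. -/
def fX (i : ℕ) : XX F :=
  ⟨⟨fun t => emb F (ff F i t), continuous_emb.comp ((continuous_ff i).comp continuous_subtype_val)⟩,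
    fun s t => by simp [ff_add], fun β t => by
      have h : ((cO F β : OO F) : KK F) = cK β := by simp [cO]
      change emb F (ff F i ((cO F β : KK F) * t)) = emb F (cK β) * emb F (ff F i t)
      rw [h, ff_smul, map_mul]⟩

@[simp] theorem ev_fX (i : ℕ) (t : OO F) : ev (fX i) t = emb F (ff F i t) := rfl

theorem aMinus_fX_zero : aMinus (fX 0 : XX F) = 0 :=
  aMinus_eq_iff.2 (XX_ext fun t => by simp [ff_zero, zero_pow qq_ne_zero])

theorem aMinus_fX_succ (i : ℕ) : aMinus (fX (i + 1) : XX F) = fX i :=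
  aMinus_eq_iff.2 (XX_ext fun t => by simp [ff_succ_xO_mul])

theorem aPlus_fX (i : ℕ) : aPlus (fX i : XX F) = emb F (br F (i + 1)) • fX (i + 1) :=
  XX_ext fun t => by simp [aPlus, ← map_mul, br_mul_ff_succ]

theorem aPlus_aMinus_fX (i : ℕ) : aPlus (aMinus (fX i : XX F)) = emb F (br F i) • fX i := by
  cases i with
  | zero =>
    rw [aMinus_fX_zero, br_zero, map_zero, zero_smul]
    exact XX_ext fun t => by simp [aPlus, zero_pow qq_ne_zero]
  | succ i => rw [aMinus_fX_succ, aPlus_fX]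

end Carlitz

/-! ## The orthonormal basis of Carlitz polynomials -/

section Basis

variable {F : Type*} [Field F] [Finite F]

theorem isUltrametricDist_XX : IsUltrametricDist (XX F) :=
  ⟨fun u v w => dist_triangle_max (u : C(OO F, Kbar F)) v w⟩

attribute [local instance] isUltrametricDist_XX

theorem exists_eq_cO_add_xO_mul (t : OO F) : ∃ (β : F) (s : OO F), t = cO F β + xO F * s := by
  obtain ⟨t, ht⟩ := t
  obtain ⟨f, rfl⟩ := (LaurentSeries.val_le_one_iff_eq_coe F t).1 ht
  have hd : (PowerSeries.X : PowerSeries F) ∣ f - PowerSeries.C (PowerSeries.constantCoeff f) := by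
    rw [PowerSeries.X_dvd_iff, map_sub, PowerSeries.constantCoeff_C, sub_self]
  obtain ⟨g, hg⟩ := hd
  refine ⟨PowerSeries.constantCoeff f, ⟨_, powerSeries_mem F g⟩, Subtype.ext ?_⟩
  change HahnSeries.ofPowerSeries ℤ F f = HahnSeries.ofPowerSeries ℤ F (PowerSeries.C _) +
    HahnSeries.ofPowerSeries ℤ F PowerSeries.X * HahnSeries.ofPowerSeries ℤ F g
  rw [← map_mul, ← map_add, ← hg, add_sub_cancel]

theorem ev_zero_right (u : XX F) : ev u 0 = 0 := by
  have h := ev_add_right u 0 0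
  rw [add_zero] at h
  exact left_eq_add.1 h

theorem tendsto_xO_pow_mul (s : ℕ → OO F) :
    Tendsto (fun n => xO F ^ n * s n) atTop (𝓝 (0 : OO F)) := by
  refine tendsto_subtype_rng.2 (squeeze_zero_norm (a := fun n => ((qq F : ℝ)⁻¹) ^ n) (fun n => ?_)
    (tendsto_pow_atTop_nhds_zero_of_lt_one (inv_nonneg.2 qq_real_pos.le)
      (inv_lt_one_of_one_lt₀ one_lt_qq_real)))
  change ‖(xO F : KK F) ^ n * (s n : KK F)‖ ≤ _
  rw [norm_mul, norm_pow, norm_xO]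
  exact mul_le_of_le_one_right (pow_nonneg (inv_nonneg.2 qq_real_pos.le) _)
    ((mem_OO F _).1 (s n).2)

theorem tendsto_ev_xO_pow_mul (u : XX F) (s : ℕ → OO F) :
    Tendsto (fun n => ev u (xO F ^ n * s n)) atTop (𝓝 0) := by
  have h := (u.1.continuous.tendsto 0).comp (tendsto_xO_pow_mul s)
  change Tendsto _ _ (𝓝 (ev u 0)) at h
  rw [ev_zero_right] at h
  exact h

/-- An element of `X` is determined by its values at the powers of `x`. -/
theorem XX_ext_xO_pow {u v : XX F} (h : ∀ n, ev u (xO F ^ n) = ev v (xO F ^ n)) : u = v := by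
  rw [← sub_eq_zero]
  set w := u - v
  have hw : ∀ n, ev w (xO F ^ n) = 0 := fun n => by rw [ev_sub, h, sub_self]
  refine XX_ext fun t => ?_
  -- Removing the first `n` coefficients of `t` does not change `w(t)`, since `w` vanishes on powers
  -- of `x`. Continuity at `0` then gives `w(t) = 0`.
  have hs : ∀ n, ∃ s, ev w t = ev w (xO F ^ n * s) := fun n => by
    induction n with
    | zero => exact ⟨t, by rw [pow_zero, one_mul]⟩
    | succ n ih =>
      obtain ⟨s, hs⟩ := ih
      obtain ⟨β, s', rfl⟩ := exists_eq_cO_add_xO_mul s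
      refine ⟨s', ?_⟩
      rw [hs, mul_add, ev_add_right, mul_comm _ (cO F β), ev_cO_mul, hw, mul_zero, zero_add,
        ← mul_assoc, ← pow_succ]
  choose s hs using hs
  exact tendsto_nhds_unique tendsto_const_nhds
    ((tendsto_ev_xO_pow_mul w s).congr fun n => (hs n).symm)

theorem norm_ev_fX_le (i : ℕ) (t : OO F) : ‖ev (fX i) t‖ ≤ 1 := by
  rw [ev_fX, norm_emb]; exact norm_ff_le i ((mem_OO F _).1 t.2)

theorem norm_smul_fX_le (c : Kbar F) (i : ℕ) : ‖c • (fX i : XX F)‖ ≤ ‖c‖ := by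
  refine norm_XX_le (norm_nonneg _) fun t => ?_
  rw [ev_smul, norm_mul]
  exact mul_le_of_le_one_right (norm_nonneg _) (norm_ev_fX_le i t)

theorem ev_fX_xO_pow_self (i : ℕ) : ev (fX i : XX F) (xO F ^ i) = 1 := by
  rw [ev_fX, SubmonoidClass.coe_pow, ff_xO_pow_self, map_one]

theorem ev_fX_xO_pow_of_lt {i j : ℕ} (h : j < i) : ev (fX i : XX F) (xO F ^ j) = 0 := by
  rw [ev_fX, SubmonoidClass.coe_pow, ff_xO_pow_of_lt h, map_zero]

theorem norm_ev_fX_xO_pow_le {i j : ℕ} (h : i < j) :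
    ‖ev (fX i : XX F) (xO F ^ j)‖ ≤ (qq F : ℝ)⁻¹ := by
  rw [ev_fX, SubmonoidClass.coe_pow, norm_emb]; exact norm_ff_xO_pow_le h

theorem summable_smul_fX {c : ℕ → Kbar F} (hc : Tendsto c atTop (𝓝 0)) :
    Summable fun i => c i • (fX i : XX F) := by
  refine NonarchimedeanAddGroup.summable_of_tendsto_cofinite_zero ?_
  rw [Nat.cofinite_eq_atTop]
  exact squeeze_zero_norm (fun i => norm_smul_fX_le (c i) i)
    (tendsto_zero_iff_norm_tendsto_zero.1 hc)

theorem ev_xO_pow_of_hasSum {c : ℕ → Kbar F} {u : XX F} (h : HasSum (fun i => c i • fX i) u)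
    (j : ℕ) :
    ev u (xO F ^ j) = ∑ i ∈ Finset.range j, c i * ev (fX i) (xO F ^ j) + c j := by
  have h1 : HasSum (fun i => c i * ev (fX i) (xO F ^ j)) (ev u (xO F ^ j)) :=
    (evL (xO F ^ j)).hasSum h
  have h2 := hasSum_sum_of_ne_finset_zero (L := .unconditional ℕ)
    (f := fun i => c i * ev (fX i : XX F) (xO F ^ j))
    (s := Finset.range (j + 1)) fun i hi => by
      rw [ev_fX_xO_pow_of_lt (by simpa using hi), mul_zero]
  rw [h1.unique h2, Finset.sum_range_succ, ev_fX_xO_pow_self, mul_one]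

theorem coeff_unique {c d : ℕ → Kbar F} {u : XX F} (hc : HasSum (fun i => c i • fX i) u)
    (hd : HasSum (fun i => d i • fX i) u) : c = d := by
  funext j
  induction j using Nat.strong_induction_on with
  | _ j ih =>
    have h := (ev_xO_pow_of_hasSum hc j).symm.trans (ev_xO_pow_of_hasSum hd j)
    rw [Finset.sum_congr rfl fun i hi => by rw [ih i (Finset.mem_range.1 hi)]] at h
    exact add_left_cancel h

/-- The coefficients of `u ∈ X` in the basis of Carlitz polynomials. -/
def coeffX (u : XX F) (j : ℕ) : Kbar F :=
  ev u (xO F ^ j) - ∑ i : Fin j, coeffX u i * ev (fX i) (xO F ^ j)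
termination_by j
decreasing_by exact i.2

theorem ev_xO_pow_eq (u : XX F) (j : ℕ) :
    ev u (xO F ^ j) =
      ∑ i ∈ Finset.range j, coeffX u i * ev (fX i) (xO F ^ j) + coeffX u j := by
  rw [coeffX.eq_1 u j, ← Fin.sum_univ_eq_sum_range fun i => coeffX u i * ev (fX i) (xO F ^ j)]
  ring

/-- Forward substitution in a unitriangular system with integral entries does not increase the
maximum norm. -/
theorem norm_coeff_le {c : ℕ → Kbar F} {u : XX F}
    (h : ∀ j, ev u (xO F ^ j) = ∑ i ∈ Finset.range j, c i * ev (fX i) (xO F ^ j) + c j) (j : ℕ) :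
    ‖c j‖ ≤ ‖u‖ := by
  induction j using Nat.strong_induction_on with
  | _ j ih =>
    rw [← sub_eq_iff_eq_add'.2 (h j), sub_eq_add_neg]
    refine (IsUltrametricDist.norm_add_le_max _ _).trans (max_le (norm_ev_le _ _) ?_)
    rw [norm_neg]
    refine IsUltrametricDist.norm_sum_le_of_forall_le_of_nonneg (norm_nonneg _) fun i hi => ?_
    rw [norm_mul]
    exact (mul_le_of_le_one_right (norm_nonneg _) (norm_ev_fX_le _ _)).trans
      (ih i (Finset.mem_range.1 hi))

theorem tendsto_coeffX (u : XX F) : Tendsto (coeffX u) atTop (𝓝 0) := by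
  have h1 : (qq F : ℝ)⁻¹ < 1 := inv_lt_one_of_one_lt₀ one_lt_qq_real
  have h0 : (0 : ℝ) < (qq F : ℝ)⁻¹ := inv_pos.2 qq_real_pos
  -- The `+ 1` only makes the bound positive.
  set M := ‖u‖ + 1 with hM
  have hMpos : 0 < M := by positivity
  have hpow : ∀ v : XX F, Tendsto (fun j => ‖ev v (xO F ^ j)‖) atTop (𝓝 0) := fun v => by
    simpa using (tendsto_ev_xO_pow_mul v fun _ => 1).norm
  -- Bootstrapping: each round gains a factor `q⁻¹`. For `i ≥ J` it comes from the entry `f_i(x^j)`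
  -- with `i < j`; the finitely many `i < J` are handled by `f_i(x^j) → 0`, and the value of `u` by
  -- `u(x^j) → 0`.
  have key : ∀ k, ∀ᶠ j in atTop, ‖coeffX u j‖ ≤ M * ((qq F : ℝ)⁻¹) ^ k := fun k => by
    induction k with
    | zero =>
      refine Eventually.of_forall fun j => ?_
      rw [pow_zero, mul_one]
      exact (norm_coeff_le (ev_xO_pow_eq u) j).trans (le_add_of_nonneg_right zero_le_one)
    | succ k ih =>
      obtain ⟨J, hJ⟩ := eventually_atTop.1 ih
      have hε : 0 < M * ((qq F : ℝ)⁻¹) ^ (k + 1) := mul_pos hMpos (pow_pos h0 _)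
      have hu := (hpow u).eventually_le_const hε
      have hf : ∀ᶠ j in atTop, ∀ i ∈ Finset.range J,
          ‖ev (fX i : XX F) (xO F ^ j)‖ ≤ ((qq F : ℝ)⁻¹) ^ (k + 1) :=
        (eventually_all_finset _).2 fun i _ => (hpow (fX i)).eventually_le_const (pow_pos h0 _)
      filter_upwards [hu, hf] with j hju hjf
      rw [← sub_eq_iff_eq_add'.2 (ev_xO_pow_eq u j), sub_eq_add_neg]
      refine (IsUltrametricDist.norm_add_le_max _ _).trans (max_le hju ?_)
      rw [norm_neg]
      refine IsUltrametricDist.norm_sum_le_of_forall_le_of_nonneg hε.le fun i hi => ?_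
      rw [norm_mul]
      rcases lt_or_ge i J with hiJ | hiJ
      · exact mul_le_mul ((norm_coeff_le (ev_xO_pow_eq u) i).trans
          (le_add_of_nonneg_right zero_le_one)) (hjf i (Finset.mem_range.2 hiJ)) (norm_nonneg _)
          hMpos.le
      · rw [pow_succ, ← mul_assoc]
        exact mul_le_mul (hJ i hiJ) (norm_ev_fX_xO_pow_le (Finset.mem_range.1 hi)) (norm_nonneg _)
          (mul_nonneg hMpos.le (pow_nonneg h0.le _))
  refine tendsto_zero_iff_norm_tendsto_zero.2 (Metric.tendsto_nhds.2 fun ε hε => ?_)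
  obtain ⟨k, hk⟩ := exists_pow_lt_of_lt_one (div_pos hε hMpos) h1
  filter_upwards [key k] with j hj
  rw [Real.dist_0_eq_abs, abs_norm]
  exact hj.trans_lt (by rwa [lt_div_iff₀' hMpos] at hk)

theorem hasSum_coeffX (u : XX F) : HasSum (fun i => coeffX u i • fX i) u := by
  have h := (summable_smul_fX (tendsto_coeffX u)).hasSum
  convert h using 1
  refine XX_ext_xO_pow fun n => ?_
  rw [ev_xO_pow_eq, ev_xO_pow_of_hasSum h]

theorem norm_le_of_hasSum {c : ℕ → Kbar F} {u : XX F} (h : HasSum (fun i => c i • fX i) u)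
    {C : ℝ} (hC : ∀ i, ‖c i‖ ≤ C) : ‖u‖ ≤ C := by
  rw [← h.tsum_eq]
  exact IsUltrametricDist.norm_tsum_le_of_forall_le fun i => (norm_smul_fX_le (c i) i).trans (hC i)

theorem isOrthonormalBasis_fX : IsOrthonormalBasis (fX : ℕ → XX F) := by
  refine fun u => ⟨⟨coeffX u, ⟨tendsto_coeffX u, hasSum_coeffX u⟩, fun d hd =>
    coeff_unique hd.2 (hasSum_coeffX u)⟩, fun c _ h => ⟨?_, fun C hC => ?_⟩⟩
  · rintro _ ⟨i, rfl⟩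
    exact norm_coeff_le (ev_xO_pow_of_hasSum h) i
  · exact norm_le_of_hasSum h fun i => hC ⟨i, rfl⟩

end Basis

/-! ## Eigenfunctions of `a⁻` -/

section Eigen

variable {F : Type*} [Field F] [Finite F]

theorem hasSum_aMinus {c : ℕ → Kbar F} {u : XX F} (h : HasSum (fun i => c i • fX i) u) :
    HasSum (fun i => rt (c (i + 1)) • fX i) (aMinus u) := by
  have h1 : HasSum (fun i => aMinus (c i • (fX i : XX F))) (aMinus u) :=
    h.map (aMinusHom : XX F →+ XX F) continuous_aMinus
  have h2 := (hasSum_nat_add_iff' 1).2 h1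
  simpa only [Finset.sum_range_one, aMinus_smul, aMinus_fX_zero, smul_zero, sub_zero,
    aMinus_fX_succ] using h2

theorem aMinus_eq_smul_iff {c : ℕ → Kbar F} {u : XX F} (h : HasSum (fun i => c i • fX i) u)
    (l : Kbar F) : aMinus u = l • u ↔ ∀ i, c (i + 1) = l ^ qq F * c i ^ qq F := by
  have h1 : HasSum (fun i => (l * c i) • (fX i : XX F)) (l • u) := by
    simpa only [smul_smul] using h.const_smul l
  have h2 := hasSum_aMinus h
  constructor
  · intro heq i
    rw [heq] at h2
    have := congrFun (coeff_unique h2 h1) i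
    rw [← mul_pow, ← this, rt_pow]
  · intro heq
    refine h2.unique ?_
    convert h1 using 3 with i
    exact rt_eq_of_pow_eq (by rw [heq, mul_pow])

theorem tendsto_pow_qq_pow {c : Kbar F} (hc : ‖c‖ < 1) :
    Tendsto (fun n => c ^ qq F ^ n) atTop (𝓝 0) :=
  (tendsto_pow_atTop_nhds_zero_of_norm_lt_one hc).comp
    (tendsto_pow_atTop_atTop_of_one_lt (one_lt_qq F))

theorem summable_coherent {c : Kbar F} (hc : ‖c‖ < 1) :
    Summable fun n => c ^ qq F ^ n • (fX n : XX F) := summable_smul_fX (tendsto_pow_qq_pow hc)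

theorem hasSum_coherent (a : Kbar F) {c : Kbar F} (hc : ‖c‖ < 1) :
    HasSum (fun n => (a * c ^ qq F ^ n) • (fX n : XX F)) (coherent fX a c) := by
  simpa only [coherent, smul_smul] using (summable_coherent hc).hasSum.const_smul a

theorem aMinus_eq_smul_iff_exists_coherent {l s : Kbar F} (hl : l ≠ 0) (hs : s ^ (qq F - 1) = l)
    (u : XX F) :
    aMinus u = l • u ↔ ∃ c : Kbar F, ‖c‖ < 1 ∧ u = coherent fX (s ^ qq F)⁻¹ c := by
  have hq : qq F - 1 ≠ 0 := (Nat.sub_pos_of_lt (one_lt_qq F)).ne'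
  have hs0 : s ≠ 0 := by rintro rfl; exact hl (by rw [← hs, zero_pow hq])
  have hsq : s ^ qq F ≠ 0 := pow_ne_zero _ hs0
  -- The amplitude `s^(-q)` is a fixed point of the recursion `y ↦ l^q y^q`, so multiplying it by
  -- `c^(q^n)` gives a solution.
  have ha : l ^ qq F * (s ^ qq F)⁻¹ ^ qq F = (s ^ qq F)⁻¹ := by
    have h1 : l * s = s ^ qq F := by rw [← hs, pow_sub_one_mul qq_ne_zero]
    have h2 : l ^ qq F * s ^ qq F = (s ^ qq F) ^ qq F := by rw [← mul_pow, h1]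
    rw [inv_pow, ← h2]
    field_simp
  have hrec : ∀ (c : Kbar F) (n : ℕ), (s ^ qq F)⁻¹ * c ^ qq F ^ (n + 1) =
      l ^ qq F * ((s ^ qq F)⁻¹ * c ^ qq F ^ n) ^ qq F := fun c n => by
    rw [mul_pow, ← mul_assoc, ha, ← pow_mul, ← pow_succ]
  constructor
  · intro h
    rw [aMinus_eq_smul_iff (hasSum_coeffX u)] at h
    set c := s ^ qq F * coeffX u 0 with hc
    have hcoeff : ∀ n, coeffX u n = (s ^ qq F)⁻¹ * c ^ qq F ^ n := fun n => by
      induction n with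
      | zero => rw [pow_zero, pow_one, hc, inv_mul_cancel_left₀ hsq]
      | succ n ih => rw [h, ih, ← hrec]
    have hc1 : ‖c‖ < 1 := by
      by_contra! hge
      have ht := (tendsto_coeffX u).const_mul (s ^ qq F)
      simp only [hcoeff, mul_inv_cancel_left₀ hsq, mul_zero] at ht
      have := ge_of_tendsto ht.norm (b := 1) (Eventually.of_forall fun n => by
        rw [norm_pow]; exact one_le_pow₀ hge)
      rw [norm_zero] at this
      exact absurd this (not_le.2 zero_lt_one)
    refine ⟨c, hc1, (hasSum_coeffX u).unique ?_⟩
    simpa only [hcoeff] using hasSum_coherent (s ^ qq F)⁻¹ hc1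
  · rintro ⟨c, hc, rfl⟩
    exact (aMinus_eq_smul_iff (hasSum_coherent _ hc) l).2 (hrec c)

theorem exists_ne_zero_aMinus_eq_smul (l : Kbar F) : ∃ u : XX F, u ≠ 0 ∧ aMinus u = l • u := by
  rcases eq_or_ne l 0 with rfl | hl
  · refine ⟨fX 0, fun h => ?_, by rw [aMinus_fX_zero, zero_smul]⟩
    have := ev_fX_xO_pow_self (F := F) 0
    rw [h, ev_zero] at this
    exact zero_ne_one this
  · obtain ⟨s, hs⟩ := exists_pow_qq_sub_one_eq l
    have hq : qq F - 1 ≠ 0 := (Nat.sub_pos_of_lt (one_lt_qq F)).ne'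
    have hs0 : s ≠ 0 := by rintro rfl; exact hl (by rw [← hs, zero_pow hq])
    have hx : ‖emb F (xO F)‖ < 1 := by
      rw [norm_emb, norm_xO]; exact inv_lt_one_of_one_lt₀ one_lt_qq_real
    have hx0 : emb F (xO F) ≠ 0 := by
      rw [← norm_ne_zero_iff, norm_emb, norm_xO]; exact inv_ne_zero qq_real_pos.ne'
    refine ⟨coherent fX (s ^ qq F)⁻¹ (emb F (xO F)), fun h => ?_,
      (aMinus_eq_smul_iff_exists_coherent hl hs _).2 ⟨_, hx, rfl⟩⟩
    have h1 := ev_xO_pow_of_hasSum (hasSum_coherent (s ^ qq F)⁻¹ hx) 0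
    rw [h, ev_zero, Finset.sum_range_zero, zero_add, pow_zero, pow_one] at h1
    exact mul_ne_zero (inv_ne_zero (pow_ne_zero _ hs0)) hx0 h1.symm

end Eigen

/-! ## The Carlitz exponential and logarithm -/

section Exponential

variable {F : Type*} [Field F] [Finite F]

/-- The ratio `‖z‖^(q-1) / q^(-1)`; it is less than `1` on the disc of convergence of `e_C`. -/
def theta (z : Kbar F) : ℝ := ‖z‖ ^ (qq F - 1) * qq F

theorem theta_nonneg (z : Kbar F) : 0 ≤ theta z :=
  mul_nonneg (pow_nonneg (norm_nonneg _) _) qq_real_pos.le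

theorem theta_mono {y z : Kbar F} (h : ‖y‖ ≤ ‖z‖) : theta y ≤ theta z :=
  mul_le_mul_of_nonneg_right (pow_le_pow_left₀ (norm_nonneg _) h _) qq_real_pos.le

theorem radC_pos : 0 < radC F := Real.rpow_pos_of_pos qq_real_pos _

theorem radC_pow : radC F ^ (qq F - 1) = (qq F : ℝ)⁻¹ := by
  have h : ((qq F - 1 : ℕ) : ℝ) = (qq F : ℝ) - 1 := by
    rw [Nat.cast_sub (one_lt_qq F).le, Nat.cast_one]
  have h0 : (qq F : ℝ) - 1 ≠ 0 := (sub_pos.2 one_lt_qq_real).ne'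
  rw [radC, ← Real.rpow_natCast, ← Real.rpow_mul qq_real_pos.le, h, ← Real.rpow_neg_one]
  congr 1
  field_simp

theorem norm_lt_radC_iff (z : Kbar F) : ‖z‖ < radC F ↔ theta z < 1 := by
  have hq : qq F - 1 ≠ 0 := (Nat.sub_pos_of_lt (one_lt_qq F)).ne'
  rw [← pow_lt_pow_iff_left₀ (norm_nonneg z) radC_pos.le hq, radC_pow, theta,
    ← one_div, lt_div_iff₀ qq_real_pos]

section GeometricSum

variable (F : Type*)

/-- The exponent `1 + q + ⋯ + q^(n-1)`. -/
def gsum (n : ℕ) : ℕ := ∑ k ∈ Finset.range n, qq F ^ k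

theorem gsum_succ (n : ℕ) : gsum F (n + 1) = qq F * gsum F n + 1 := by
  rw [gsum, Finset.sum_range_succ', gsum, Finset.mul_sum, pow_zero]
  simp only [pow_succ']

end GeometricSum

theorem le_gsum (n : ℕ) : n ≤ gsum F n := by
  have h : ∑ k ∈ Finset.range n, 1 ≤ gsum F n :=
    Finset.sum_le_sum fun k _ => Nat.one_le_pow _ _ qq_pos
  simpa using h

theorem qq_pow_eq (n : ℕ) : qq F ^ n = (qq F - 1) * gsum F n + 1 := by
  induction n with
  | zero => simp [gsum]
  | succ n ih =>
    obtain ⟨m, hm⟩ : ∃ m, qq F = m + 1 := ⟨qq F - 1, by have := one_lt_qq F; lia⟩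
    rw [gsum_succ, pow_succ, ih, hm, Nat.add_sub_cancel]
    ring

theorem norm_DD (n : ℕ) : ‖DD F n‖ = ((qq F : ℝ)⁻¹) ^ gsum F n := by
  induction n with
  | zero => simp [gsum]
  | succ n ih =>
    rw [DD_succ, norm_mul, norm_pow, ih, norm_br F (by lia), gsum_succ, pow_succ', ← pow_mul,
      mul_comm (gsum F n)]

theorem norm_pow_qq_pow (z : Kbar F) (n : ℕ) :
    ‖z‖ ^ qq F ^ n = ‖z‖ * (‖z‖ ^ (qq F - 1)) ^ gsum F n := by
  rw [qq_pow_eq, pow_succ', pow_mul]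

/-- Since `q^n = (q-1) gsum n + 1` and `|D_n| = q^(-gsum n)`, the norm of the term is exactly `|z|
θ^(gsum n)`, and `gsum n ≥ n`. -/
theorem norm_eCTerm_le {z : Kbar F} (hz : theta z < 1) (n : ℕ) :
    ‖eCTerm z n‖ ≤ ‖z‖ * theta z ^ n := by
  rw [eCTerm, norm_div, norm_pow, norm_emb, norm_DD, norm_pow_qq_pow, inv_pow, div_inv_eq_mul,
    mul_assoc, ← mul_pow]
  exact mul_le_mul_of_nonneg_left (pow_le_pow_of_le_one (theta_nonneg z) hz.le (le_gsum n))
    (norm_nonneg _)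

theorem norm_rhoTerm_le {z : Kbar F} (hz : theta z < 1) (n : ℕ) :
    ‖rhoTerm z n‖ ≤ ‖z‖ * theta z ^ n := by
  have h1 : ‖z‖ ^ (qq F - 1) ≤ 1 :=
    (le_mul_of_one_le_right (pow_nonneg (norm_nonneg _) _) one_lt_qq_real.le).trans hz.le
  rw [rhoTerm, norm_div, norm_mul, norm_pow, norm_pow, norm_neg, norm_one, one_pow, one_mul,
    norm_emb, norm_LL, norm_pow_qq_pow, inv_pow, div_inv_eq_mul, mul_assoc, theta, mul_pow]
  gcongr ‖z‖ * (?_ * _)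
  exact pow_le_pow_of_le_one (pow_nonneg (norm_nonneg _) _) h1 (le_gsum n)

section GeometricBound

variable {T : ℕ → Kbar F} {a θ : ℝ}

theorem summable_of_norm_le_geometric (hθ0 : 0 ≤ θ) (hθ : θ < 1)
    (hT : ∀ n, ‖T n‖ ≤ a * θ ^ n) : Summable T :=
  Summable.of_norm_bounded ((summable_geometric_of_lt_one hθ0 hθ).mul_left a) hT

theorem norm_tsum_sub_le_of_norm_le_geometric (hθ0 : 0 ≤ θ) (hθ : θ < 1)
    (ha : 0 ≤ a) (hT : ∀ n, ‖T n‖ ≤ a * θ ^ n) : ‖∑' n, T n - T 0‖ ≤ a * θ := by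
  rw [(summable_of_norm_le_geometric hθ0 hθ hT).tsum_eq_zero_add, add_sub_cancel_left]
  refine IsUltrametricDist.norm_tsum_le_of_forall_le fun n => (hT _).trans ?_
  exact mul_le_mul_of_nonneg_left (pow_le_of_le_one hθ0 hθ.le (by lia)) ha

end GeometricBound

@[simp] theorem eCTerm_zero (z : Kbar F) : eCTerm z 0 = z := by simp [eCTerm]

@[simp] theorem rhoTerm_zero (z : Kbar F) : rhoTerm z 0 = z := by simp [rhoTerm]

theorem summable_eCTerm {z : Kbar F} (hz : theta z < 1) : Summable (eCTerm z) :=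
  summable_of_norm_le_geometric (theta_nonneg z) hz (norm_eCTerm_le hz)

theorem summable_rhoTerm {z : Kbar F} (hz : theta z < 1) : Summable (rhoTerm z) :=
  summable_of_norm_le_geometric (theta_nonneg z) hz (norm_rhoTerm_le hz)

theorem norm_eC_sub_le {z : Kbar F} (hz : theta z < 1) : ‖eC z - z‖ ≤ ‖z‖ * theta z := by
  simpa only [eCTerm_zero, eC] using norm_tsum_sub_le_of_norm_le_geometric (theta_nonneg z) hz
    (norm_nonneg z) (norm_eCTerm_le hz)

theorem norm_rho_sub_le {z : Kbar F} (hz : theta z < 1) : ‖rho z - z‖ ≤ ‖z‖ * theta z := by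
  simpa only [rhoTerm_zero, rho] using norm_tsum_sub_le_of_norm_le_geometric (theta_nonneg z) hz
    (norm_nonneg z) (norm_rhoTerm_le hz)

theorem norm_le_of_norm_sub_le {y z : Kbar F} (hz : theta z < 1) (h : ‖y - z‖ ≤ ‖z‖ * theta z) :
    ‖y‖ ≤ ‖z‖ := by
  rw [← sub_add_cancel y z]
  exact (IsUltrametricDist.norm_add_le_max _ _).trans
    (max_le (h.trans (mul_le_of_le_one_right (norm_nonneg _) hz.le)) le_rfl)

theorem norm_eC_le {z : Kbar F} (hz : theta z < 1) : ‖eC z‖ ≤ ‖z‖ :=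
  norm_le_of_norm_sub_le hz (norm_eC_sub_le hz)

theorem norm_rho_le {z : Kbar F} (hz : theta z < 1) : ‖rho z‖ ≤ ‖z‖ :=
  norm_le_of_norm_sub_le hz (norm_rho_sub_le hz)

/-! ### Additivity and functional equations of `e_C` and `ρ` -/

theorem add_pow_qq_pow (y z : Kbar F) (n : ℕ) :
    (y + z) ^ qq F ^ n = y ^ qq F ^ n + z ^ qq F ^ n := map_add (frob F n) y z

theorem eC_add {y z : Kbar F} (hy : theta y < 1) (hz : theta z < 1) :
    eC (y + z) = eC y + eC z := by
  rw [eC, eC, eC, ← (summable_eCTerm hy).tsum_add (summable_eCTerm hz)]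
  simp only [eCTerm, add_pow_qq_pow, add_div]

theorem rho_add {y z : Kbar F} (hy : theta y < 1) (hz : theta z < 1) :
    rho (y + z) = rho y + rho z := by
  rw [rho, rho, rho, ← (summable_rhoTerm hy).tsum_add (summable_rhoTerm hz)]
  simp only [rhoTerm, add_pow_qq_pow, mul_add, add_div]

theorem eC_cbar_mul (β : F) (z : Kbar F) : eC (cbar F β * z) = cbar F β * eC z := by
  rw [eC, eC, ← tsum_mul_left]
  simp only [eCTerm, mul_pow, ← map_pow, pow_qq_pow, mul_div_assoc]

theorem theta_emb_mul_lt {t : KK F} (ht : ‖t‖ ≤ 1) {z : Kbar F} (hz : theta z < 1) :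
    theta (emb F t * z) < 1 := by
  refine (theta_mono ?_).trans_lt hz
  rw [norm_mul, norm_emb]
  exact mul_le_of_le_one_left (norm_nonneg _) ht

theorem emb_xO_pow (n : ℕ) : emb F (xO F) ^ qq F ^ n = emb F (xO F) + emb F (br F n) := by
  rw [br, map_sub, map_pow]; ring

theorem emb_DD_ne_zero (n : ℕ) : emb F (DD F n) ≠ 0 := (map_ne_zero _).2 (DD_ne_zero F n)

theorem emb_br_succ_ne_zero (n : ℕ) : emb F (br F (n + 1)) ≠ 0 :=
  (map_ne_zero _).2 (br_ne_zero F (by lia))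

theorem LL_ne_zero (n : ℕ) : LL F n ≠ 0 := by
  rw [← norm_ne_zero_iff, norm_LL]; exact pow_ne_zero _ (inv_ne_zero qq_real_pos.ne')

theorem theta_pow_qq_lt {z : Kbar F} (hz : theta z < 1) : theta (z ^ qq F) < 1 := by
  have h1 : ‖z‖ ^ (qq F - 1) ≤ 1 :=
    (le_mul_of_one_le_right (pow_nonneg (norm_nonneg _) _) one_lt_qq_real.le).trans hz.le
  refine (theta_mono ?_).trans_lt hz
  rw [norm_pow, ← pow_sub_one_mul qq_ne_zero]
  exact mul_le_of_le_one_left (norm_nonneg _) h1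

theorem norm_xO_le : ‖(xO F : KK F)‖ ≤ 1 := (mem_OO F _).1 (xO F).2

/-- In the termwise difference the index `0` cancels. Term `n + 1` carries `x^(q^(n+1)) - x =
[n+1]`, which cancels in `D_{n+1} = [n+1] D_n^q` and leaves the `q`-th power of term `n`. -/
theorem eC_xO_mul {z : Kbar F} (hz : theta z < 1) :
    eC (emb F (xO F) * z) = emb F (xO F) * eC z + eC z ^ qq F := by
  have h1 := (summable_eCTerm (theta_emb_mul_lt norm_xO_le hz)).hasSum.sub
    ((summable_eCTerm hz).hasSum.mul_left (emb F (xO F)))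
  have h2 := (hasSum_nat_add_iff' 1).2 h1
  have h3 : HasSum (fun n => eCTerm z n ^ qq F) (eC z ^ qq F) := by
    have := (summable_eCTerm hz).hasSum.map (frob F 1) (by
      change Continuous fun w : Kbar F => w ^ qq F ^ 1
      fun_prop)
    simpa only [eC, Function.comp_def, frobPow_apply, pow_one] using this
  have h4 : ∀ n, eCTerm (emb F (xO F) * z) (n + 1) - emb F (xO F) * eCTerm z (n + 1) =
      eCTerm z n ^ qq F := fun n => by
    have hb := emb_br_succ_ne_zero (F := F) n
    have hD := emb_DD_ne_zero (F := F) n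
    simp only [eCTerm, mul_pow, emb_xO_pow, DD_succ, map_mul, map_pow, div_pow, ← pow_mul,
      ← pow_succ]
    field_simp
    ring
  simp only [h4, Finset.sum_range_one, eCTerm_zero, sub_self, sub_zero] at h2
  have h5 := h3.unique h2
  change _ = eC (emb F (xO F) * z) - emb F (xO F) * eC z at h5
  rw [h5]; ring

theorem rho_xO_mul {z : Kbar F} (hz : theta z < 1) :
    rho (emb F (xO F) * z) = emb F (xO F) * rho z - rho (z ^ qq F) := by
  have h1 := (summable_rhoTerm (theta_emb_mul_lt norm_xO_le hz)).hasSum.sub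
    ((summable_rhoTerm hz).hasSum.mul_left (emb F (xO F)))
  have h2 := (hasSum_nat_add_iff' 1).2 h1
  have h3 := (summable_rhoTerm (theta_pow_qq_lt hz)).hasSum.neg
  have h4 : ∀ n, rhoTerm (emb F (xO F) * z) (n + 1) - emb F (xO F) * rhoTerm z (n + 1) =
      -rhoTerm (z ^ qq F) n := fun n => by
    have hb := emb_br_succ_ne_zero (F := F) n
    have hL : emb F (LL F n) ≠ 0 := (map_ne_zero _).2 (LL_ne_zero n)
    simp only [rhoTerm, mul_pow, emb_xO_pow, LL_succ, map_mul, ← pow_mul, ← pow_succ',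
      pow_succ (-1 : Kbar F)]
    field_simp
    ring
  simp only [h4, Finset.sum_range_one, rhoTerm_zero, sub_self, sub_zero] at h2
  have h5 := h3.unique h2
  change -rho (z ^ qq F) = rho (emb F (xO F) * z) - emb F (xO F) * rho z at h5
  linear_combination -h5

/-- On this disc `|z^q| < |xz|` for `z ≠ 0`, so the Carlitz action `z ↦ xz + z^q` of `x` scales
norms exactly by `q⁻¹`. -/
theorem norm_xO_mul_add_pow {z : Kbar F} (hz : theta z < 1) :
    ‖emb F (xO F) * z + z ^ qq F‖ = (qq F : ℝ)⁻¹ * ‖z‖ := by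
  have hx : ‖emb F (xO F) * z‖ = (qq F : ℝ)⁻¹ * ‖z‖ := by rw [norm_mul, norm_emb, norm_xO]
  rcases eq_or_ne z 0 with rfl | hz0
  · simp [zero_pow qq_ne_zero]
  have hlt : ‖z ^ qq F‖ < ‖emb F (xO F) * z‖ := by
    rw [hx, norm_pow, ← pow_sub_one_mul qq_ne_zero]
    refine mul_lt_mul_of_pos_right ?_ (norm_pos_iff.2 hz0)
    rw [theta] at hz
    rwa [← one_div, lt_div_iff₀ qq_real_pos]
  rw [IsUltrametricDist.norm_add_eq_max_of_norm_ne_norm hlt.ne', max_eq_left hlt.le, hx]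

/-- The function `ρ` is a right inverse of the Carlitz exponential. -/
theorem eC_rho {c : Kbar F} (hc : theta c < 1) : eC (rho c) = c := by
  have hQ0 : (0 : ℝ) < (qq F : ℝ)⁻¹ := inv_pos.2 qq_real_pos
  have hQ1 : (qq F : ℝ)⁻¹ < 1 := inv_lt_one_of_one_lt₀ one_lt_qq_real
  have hρ : ∀ {c : Kbar F}, theta c < 1 → theta (rho c) < 1 := fun hc =>
    (theta_mono (norm_rho_le hc)).trans_lt hc
  have h0 : ∀ {c : Kbar F}, theta c < 1 → ‖eC (rho c) - c‖ ≤ ‖c‖ * theta c := fun {c} hc => by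
    rw [← sub_add_sub_cancel _ (rho c)]
    refine (IsUltrametricDist.norm_add_le_max _ _).trans (max_le ?_ (norm_rho_sub_le hc))
    refine (norm_eC_sub_le (hρ hc)).trans ?_
    exact mul_le_mul (norm_rho_le hc) (theta_mono (norm_rho_le hc)) (theta_nonneg _)
      (norm_nonneg _)
  -- Let `E(c) = e_C(ρ(c)) - c` and `φ(c) = xc + c^q`. Then `ρ(φ(c)) = xρ(c)` and `E(φ(c)) =
  -- φ(E(c))`. Applying the bound to `φ(c)`, the scaling by `q⁻¹` cancels on both sides, while
  -- `θ(φ(c)) ≤ θ(c)/q` gains a factor. Iteration forces `E(c) = 0`.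
  have key : ∀ n : ℕ, ∀ c : Kbar F, theta c < 1 →
      ‖eC (rho c) - c‖ ≤ ‖c‖ * theta c * ((qq F : ℝ)⁻¹) ^ n := fun n => by
    induction n with
    | zero => intro c hc; rw [pow_zero, mul_one]; exact h0 hc
    | succ n ih =>
      intro c hc
      have hnorm := norm_xO_mul_add_pow hc
      have hh : theta (eC (rho c) - c) < 1 := (theta_mono ((h0 hc).trans
        (mul_le_of_le_one_right (norm_nonneg _) hc.le))).trans_lt hc
      set c' := emb F (xO F) * c + c ^ qq F with hc'
      have hθ : theta c' ≤ theta c * (qq F : ℝ)⁻¹ := by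
        have hθ' : theta c' = theta c * ((qq F : ℝ)⁻¹) ^ (qq F - 1) := by
          rw [theta, hnorm, mul_pow, theta]; ring
        rw [hθ']
        refine mul_le_mul_of_nonneg_left ?_ (theta_nonneg c)
        exact pow_le_of_le_one hQ0.le hQ1.le (Nat.sub_pos_of_lt (one_lt_qq F)).ne'
      have hθ1 : theta c' < 1 :=
        (hθ.trans (mul_le_of_le_one_right (theta_nonneg c) hQ1.le)).trans_lt hc
      have hrho : rho c' = emb F (xO F) * rho c := by
        rw [hc', rho_add (theta_emb_mul_lt norm_xO_le hc) (theta_pow_qq_lt hc), rho_xO_mul hc,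
          sub_add_cancel]
      have hdiff : eC (rho c') - c' =
          emb F (xO F) * (eC (rho c) - c) + (eC (rho c) - c) ^ qq F := by
        rw [hrho, eC_xO_mul (hρ hc), sub_pow_qq, hc']; ring
      have h1 := ih c' hθ1
      rw [hdiff, norm_xO_mul_add_pow hh, hnorm, mul_assoc, mul_assoc] at h1
      refine (le_of_mul_le_mul_left h1 hQ0).trans ?_
      rw [mul_assoc, pow_succ', ← mul_assoc (theta c)]
      exact mul_le_mul_of_nonneg_left (mul_le_mul_of_nonneg_right hθ (pow_nonneg hQ0.le _))
        (norm_nonneg _)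
  have hlim : Tendsto (fun n : ℕ => ‖c‖ * theta c * ((qq F : ℝ)⁻¹) ^ n) atTop (𝓝 0) := by
    simpa using (tendsto_pow_atTop_nhds_zero_of_lt_one hQ0.le hQ1).const_mul (‖c‖ * theta c)
  have h := ge_of_tendsto' hlim fun n => key n c hc
  exact sub_eq_zero.1 (norm_le_zero_iff.1 h)

/-- The function `t ↦ e_C(t z)` as an element of `X`. -/
def eCX (z : Kbar F) (hz : theta z < 1) : XX F :=
  have hθ : ∀ t : OO F, theta (emb F t * z) < 1 := fun t =>
    theta_emb_mul_lt ((mem_OO F _).1 t.2) hz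
  have hadd : ∀ s t : OO F, eC (emb F (s + t : OO F) * z) = eC (emb F s * z) + eC (emb F t * z) :=
    fun s t => by
      rw [← eC_add (hθ s) (hθ t), ← add_mul, ← map_add]; rfl
  ⟨⟨fun t => eC (emb F t * z), by
      refine continuous_of_continuousAt_zero
        (AddMonoidHom.mk' (fun t : OO F => eC (emb F t * z)) hadd) ?_
      rw [ContinuousAt, map_zero]
      refine squeeze_zero_norm (fun t => norm_eC_le (hθ t)) ?_
      have hc : Continuous fun t : OO F => ‖emb F t * z‖ :=
        ((continuous_emb.comp continuous_subtype_val).mul continuous_const).norm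
      simpa using hc.tendsto 0⟩,
    hadd, fun β t => by
      have h : emb F (cO F β * t : OO F) = cbar F β * emb F t := by
        rw [← emb_cO, ← map_mul]; rfl
      change eC (emb F (cO F β * t : OO F) * z) = cbar F β * eC (emb F t * z)
      rw [h, mul_assoc, eC_cbar_mul]⟩

theorem ev_eCX (z : Kbar F) (hz : theta z < 1) (t : OO F) :
    ev (eCX z hz) t = eC (emb F t * z) := rfl

theorem aMinus_eCX (z : Kbar F) (hz : theta z < 1) : aMinus (eCX z hz) = eCX z hz := by
  refine aMinus_eq_iff.2 (XX_ext fun t => ?_)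
  have h : emb F (xO F * t : OO F) = emb F (xO F) * emb F t := by rw [← map_mul]; rfl
  rw [ev_Rq, ev_Delta, ev_eCX, ev_eCX, h, mul_assoc,
    eC_xO_mul (theta_emb_mul_lt ((mem_OO F _).1 t.2) hz), add_sub_cancel_left]

theorem hasSum_eCX_rho {c : Kbar F} (hc : theta c < 1) (hρ : theta (rho c) < 1) :
    HasSum (fun n => c ^ qq F ^ n • (fX n : XX F)) (eCX (rho c) hρ) := by
  have h := hasSum_coeffX (eCX (rho c) hρ)
  have h1 := (aMinus_eq_smul_iff h 1).1 (by rw [one_smul, aMinus_eCX])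
  -- The zeroth coefficient is the value at `t = 1`, namely `e_C(ρ(c))`.
  have h0 : coeffX (eCX (rho c) hρ) 0 = c := by
    have := ev_xO_pow_eq (eCX (rho c) hρ) 0
    rw [Finset.sum_range_zero, zero_add, pow_zero, ev_eCX] at this
    rw [← this, OneMemClass.coe_one, map_one, one_mul, eC_rho hc]
  have hn : ∀ n, coeffX (eCX (rho c) hρ) n = c ^ qq F ^ n := fun n => by
    induction n with
    | zero => rw [h0, pow_zero, pow_one]
    | succ n ih => rw [h1, ih, one_pow, one_mul, ← pow_mul, ← pow_succ]
  simpa only [hn] using h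

theorem hasExpForm_coherent (a : Kbar F) {c : Kbar F} (hc : ‖c‖ < radC F) :
    HasExpForm a c (coherent fX a c) := by
  have hθ := (norm_lt_radC_iff c).1 hc
  have hρ : theta (rho c) < 1 := (theta_mono (norm_rho_le hθ)).trans_lt hθ
  refine ⟨summable_rhoTerm hθ, (norm_lt_radC_iff _).2 hρ, fun t =>
    ⟨summable_eCTerm (theta_emb_mul_lt ((mem_OO F _).1 t.2) hρ), ?_⟩⟩
  rw [coherent, (hasSum_eCX_rho hθ hρ).tsum_eq, ev_smul, ev_eCX]

theorem norm_le_of_norm_lt_one {c : KK F} (hc : ‖c‖ < 1) : ‖c‖ ≤ (qq F : ℝ)⁻¹ := by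
  obtain ⟨f, rfl⟩ := (LaurentSeries.val_le_one_iff_eq_coe F c).1
    (Valued.toNormedField.norm_le_one_iff.1 hc.le)
  have h0 : PowerSeries.constantCoeff f = 0 := by
    by_contra hne
    -- A nonzero constant term would make `f` a unit with integral inverse, so `|f| < 1` would fail.
    have h1 := (mem_OO F _).1 (powerSeries_mem F f⁻¹)
    have h2 := congrArg (fun g => ‖HahnSeries.ofPowerSeries ℤ F g‖)
      (PowerSeries.mul_inv_cancel f hne)
    simp only [map_mul, map_one, norm_mul, norm_one] at h2
    exact (mul_lt_one_of_nonneg_of_lt_one_left (norm_nonneg _) hc h1).ne h2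
  obtain ⟨g, rfl⟩ := PowerSeries.X_dvd_iff.2 h0
  have hg := (mem_OO F _).1 (powerSeries_mem F g)
  have hx := norm_xO F
  change ‖HahnSeries.ofPowerSeries ℤ F PowerSeries.X‖ = _ at hx
  rw [map_mul, norm_mul, hx]
  exact mul_le_of_le_one_right (inv_nonneg.2 qq_real_pos.le) hg

theorem norm_emb_lt_radC (hq : qq F ≠ 2) {c : KK F} (hc : ‖c‖ < 1) : ‖emb F c‖ < radC F := by
  have hQ0 : (0 : ℝ) < (qq F : ℝ)⁻¹ := inv_pos.2 qq_real_pos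
  have hQ1 : (qq F : ℝ)⁻¹ < 1 := inv_lt_one_of_one_lt₀ one_lt_qq_real
  -- After raising to the power `q - 1` the claim is `q^(-(q-1)) < q⁻¹`, which fails precisely for
  -- `q = 2`.
  have h2 : 1 < qq F - 1 := by have := one_lt_qq F; lia
  rw [norm_emb]
  refine (norm_le_of_norm_lt_one hc).trans_lt (lt_of_pow_lt_pow_left₀ (qq F - 1) radC_pos.le ?_)
  rw [radC_pow]
  exact pow_lt_self_of_lt_one₀ hQ0 hQ1 h2

end Exponential

end CarlitzOscillator

end

theorem mainTheorem1 (F : Type*) [Field F] [Finite F] :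
    -- `a⁻` is well defined: the `q`-th root is unique, and `Δ` maps `X` into `{u^q : u ∈ X}`
    (Function.Injective (Rq : XX F → XX F) ∧ ∀ u : XX F, Delta u ∈ Set.range (Rq : XX F → XX F)) ∧
    -- (i)
    (IsFLinear (aPlus : XX F → XX F) ∧ Continuous (aPlus : XX F → XX F) ∧
      IsFLinear (aMinus : XX F → XX F) ∧ Continuous (aMinus : XX F → XX F) ∧
      ∃ r : Kbar F, r ^ qq F = emb F (br F 1) ∧
        ∀ u : XX F, aMinus (aPlus u) - aPlus (aMinus u) = r • u) ∧
    -- the Carlitz polynomials, as elements of `X`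
    ∃ f : ℕ → XX F, (∀ i (t : OO F), ev (f i) t = emb F (ff F i t)) ∧
      -- (ii)
      (IsOrthonormalBasis f ∧
        (∀ i, aPlus (aMinus (f i)) = emb F (br F i) • f i) ∧
        (∀ i, 1 ≤ i → aPlus (f (i - 1)) = emb F (br F i) • f i) ∧
        (∀ i, 1 ≤ i → aMinus (f i) = f (i - 1)) ∧
        aMinus (f 0) = 0) ∧
      -- (iii)
      ((∀ l : Kbar F, ∃ u : XX F, u ≠ 0 ∧ aMinus u = l • u) ∧
        (∀ c : Kbar F, ‖c‖ < 1 → Summable fun n => c ^ qq F ^ n • f n) ∧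
        ∀ l : Kbar F, l ≠ 0 →
          (∃ s : Kbar F, s ^ (qq F - 1) = l) ∧
          ∀ s : Kbar F, s ^ (qq F - 1) = l →
            (∀ u : XX F, aMinus u = l • u ↔
              ∃ c : Kbar F, ‖c‖ < 1 ∧ u = coherent f (s ^ qq F)⁻¹ c) ∧
            (∀ c : Kbar F, ‖c‖ < radC F →
              HasExpForm (s ^ qq F)⁻¹ c (coherent f (s ^ qq F)⁻¹ c)) ∧
            (qq F ≠ 2 → ∀ c : KK F, ‖c‖ < 1 →
              HasExpForm (s ^ qq F)⁻¹ (emb F c) (coherent f (s ^ qq F)⁻¹ (emb F c)))) :=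
  ⟨⟨Rq_injective, fun u => mem_range_Rq (Delta u)⟩,
    ⟨isFLinear_aPlus, continuous_aPlus, isFLinear_aMinus, continuous_aMinus,
      rt (emb F (br F 1)), rt_pow _, commutator⟩,
    fX, fun _ _ => rfl,
    ⟨isOrthonormalBasis_fX, aPlus_aMinus_fX,
      fun i hi => by
        obtain ⟨i, rfl⟩ := Nat.exists_eq_add_of_le' hi
        exact aPlus_fX i,
      fun i hi => by
        obtain ⟨i, rfl⟩ := Nat.exists_eq_add_of_le' hi
        exact aMinus_fX_succ i,
      aMinus_fX_zero⟩,
    exists_ne_zero_aMinus_eq_smul, fun _ => summable_coherent,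
    fun l hl => ⟨exists_pow_qq_sub_one_eq l, fun _ hs =>
      ⟨aMinus_eq_smul_iff_exists_coherent hl hs, fun _ => hasExpForm_coherent _,
        fun hq _ hc => hasExpForm_coherent _ (norm_emb_lt_radC hq hc)⟩⟩⟩
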